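/- Let $\mathrm{Zero}=\{x0\mid x\in\{0,1\}^*\}$ be the (regular) language of all binary strings that end in $0$. Then $\mathrm{Zero}$ does not belong to $\mathrm{QIP}^{\#}_1(1qfa)$, the class of all languages recognized with bounded error probability by $1$-interaction bounded quantum interactive proof (QIP) systems with measure-many one-way quantum finite automaton (1qfa) verifiers and committed provers. Here the notions are as follows. A 1qfa verifier $V$ has a finite set $Q$ of inner states containing $q_0$ and partitioned into $Q_{acc},Q_{rej},Q_{non}$ with $q_0\in Q_{non}$, a finite communication alphabet $\Gamma$ with blank $\#$, and transition amplitudes $\delta(q,\sigma,\gamma,q',\gamma',d)\in\mathbb C$ that vanish unless the head direction is $d=+1$, such that on every input $x$ of length $n$, written as $\text{¢}\,x\,\$$ on a circular tape of $n+2$ cells, the induced operator $U^x_\delta$ on the space spanned by all $|q,k,\gamma\rangle$ ($q\in Q$, $k\in\mathbb Z_{n+2}$, $\gamma\in\Gamma$) is unitary. A prover $P$ has a semi-infinite private tape over a finite alphabet $\Delta$ with a blank $\#$ and, for every input $x$ and every $i\ge 1$, a unitary operator $U^x_{P,i}$ acting on the communication cell and a finite initial segment of its private tape, and as the identity on the rest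 of that tape. The computation of $(P,V)$ on $x$ starts in $|q_0,0\rangle|\#\rangle|\#^\infty\rangle$; the players alternate, starting with $V$. In each of the $n+2$ steps of $V$, $U^x_\delta$ is applied and it is measured whether the inner state is accepting, rejecting or non-halting; only the non-halting part continues, and in its $i$-th turn $P$ applies $U^x_{P,i}$ to it. The acceptance (rejection) probability is the sum over these steps of the probabilities of accepting (rejecting). Let $S_0=\{\#^\infty\}$ and let $S_i$ be the set of private tape contents $y$ such that $|\tau\rangle|y\rangle$ has non-zero amplitude in $U^x_{P,i}|\sigma\rangle|z\rangle$ for some $z\in S_{i-1}$ and $\sigma,\tau\in\Gamma$. The prover $P$ is committed if, on every input $x$, $U^x_{P,i}|\#\rangle|y\rangle=|\#\rangle|y\rangle$ for all $i\ge1$ and $y\in S_{i-1}$. A query configuration is a non-halting global configuration in which $V$ has just written a non-blank symbol in the communication cell. A computation path is a sequence of global configurations starting with the initial one, each having non-zero amplitude in the corresponding superposition of the computation and each obtained with non-zero amplitude from the preceding one by the corresponding move. The number of interactions of $(P,V)$ on $x$ is the maximum, over all computation paths, of the number of query configurations along the path. A language $L$ belongs to $\mathrm{QIP}^{\#}_k(1qfa)$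 if there are a 1qfa verifier $V$, a committed prover $P$ and a constant $\epsilon\in[0,1/2)$ such that: for every $x\in L$, $(P,V)$ accepts $x$ with probability at least $1-\epsilon$ and makes at most $k$ interactions on $x$; and for every $x\notin L$ and every committed prover $P^*$, $(P^*,V)$ rejects $x$ with probability at least $1-\epsilon$ and makes at most $k$ interactions on $x$. -/

import Mathlib

namespace QIP

/-- Tape symbols: input symbols together with the left endmarker (cent) and the right endmarker
(dollar). -/
inductive TapeSymbol (α : Type) : Type
  | cent : TapeSymbol α
  | sym (a : α) : TapeSymbol α
  | dollar : TapeSymbol α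

/-- The symbol `x_(k)` in cell `k` of the circular input tape holding `¢ x $`
(cells are indexed by the integers modulo `|x| + 2`). -/
def symbolAt {α : Type} (x : List α) (k : ZMod (x.length + 2)) : TapeSymbol α :=
  if k.val = 0 then TapeSymbol.cent
  else
    match x[k.val - 1]? with
    | some a => TapeSymbol.sym a
    | none => TapeSymbol.dollar

/-! ### Verifiers -/

/-- The data of a quantum finite automaton verifier with inner states `Q`, input alphabet `α` and
communication alphabet `Γ`.  `δ q σ γ q' γ' d` is the amplitude of changing `q, γ` into `q', γ'`
and moving the head in direction `d ∈ {0, ±1}` when `σ` is scanned.  States outside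
`acc ∪ rej` are the non-halting ones. -/
structure Verifier (α Q Γ : Type) where
  δ : Q → TapeSymbol α → Γ → Q → Γ → SignType → ℂ
  init : Q
  acc : Set Q
  rej : Set Q
  blank : Γ
  disjoint_acc_rej : Disjoint acc rej
  init_not_acc : init ∉ acc
  init_not_rej : init ∉ rej

namespace Verifier

variable {α Q Γ : Type}

/-- The non-halting inner states. -/
def non (V : Verifier α Q Γ) : Set Q := (V.acc ∪ V.rej)ᶜ

/-- The matrix of the operator `U_δ^x` on the verifier's visible configuration space, with basis
the triples (inner state, head position, communication symbol).  The entry in row `c'` and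
column `c` is the amplitude of passing from `c` to `c'`. -/
def stepMatrix (V : Verifier α Q Γ) (x : List α) :
    Matrix (Q × ZMod (x.length + 2) × Γ) (Q × ZMod (x.length + 2) × Γ) ℂ :=
  fun c' c => ∑ d : SignType,
    if c'.2.1 = c.2.1 + (d : ZMod (x.length + 2)) then
      V.δ c.1 (symbolAt x c.2.1) c.2.2 c'.1 c'.2.2 d
    else 0

/-- Well-formedness: `U_δ^x` is unitary for every input `x`. -/
def WellFormed [Fintype Q] [DecidableEq Q] [Fintype Γ] [DecidableEq Γ]
    (V : Verifier α Q Γ) : Prop :=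
  ∀ x : List α, V.stepMatrix x ∈ Matrix.unitaryGroup (Q × ZMod (x.length + 2) × Γ) ℂ

/-- One-way verifiers: the head moves to the right at every step. -/
def IsOneWay (V : Verifier α Q Γ) : Prop :=
  ∀ q σ γ q' γ' d, d ≠ 1 → V.δ q σ γ q' γ' d = 0

end Verifier

/-! ### Provers -/

/-- Contents of a semi-infinite private tape with only finitely many non-blank cells. -/
def PrivateTape (Δ : Type) (b : Δ) : Type := {y : ℕ → Δ // {i | y i ≠ b}.Finite}

namespace PrivateTape

variable {Δ : Type} {b : Δ}

/-- The tape that is blank everywhere. -/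
def allBlank : PrivateTape Δ b := ⟨fun _ => b, by simp⟩

/-- The content of the first `m` cells. -/
def front (m : ℕ) (y : PrivateTape Δ b) : Fin m → Δ := fun i => y.1 i

/-- Overwrite the first `m` cells by `u`. -/
def overwrite {m : ℕ} (y : PrivateTape Δ b) (u : Fin m → Δ) : PrivateTape Δ b :=
  ⟨fun i => if h : i < m then u ⟨i, h⟩ else y.1 i, by
    refine ((Set.finite_Iio m).union y.2).subset ?_
    intro i hi
    by_cases h : i < m
    · exact Or.inl h
    · right
      simpa [h] using hi⟩

end PrivateTape

/-- One operation `S ⊗ I` of a prover: a unitary `S` on the communication cell and the first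
`cells` cells of the private tape, and the identity on the rest of the private tape. -/
structure ProverMove (Γ Δ : Type) [Fintype Γ] [DecidableEq Γ] [Fintype Δ] [DecidableEq Δ] where
  cells : ℕ
  S : Matrix.unitaryGroup (Γ × (Fin cells → Δ)) ℂ

namespace ProverMove

variable {Γ Δ : Type} [Fintype Γ] [DecidableEq Γ] [Fintype Δ] [DecidableEq Δ]

/-- The image `(S ⊗ I)|γ⟩|y⟩` of a basis vector of the prover's visible configuration space.  It
is a finite linear combination of basis vectors. -/
noncomputable def onBasis (M : ProverMove Γ Δ) {b : Δ} (γ : Γ) (y : PrivateTape Δ b) :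
    (Γ × PrivateTape Δ b) →₀ ℂ :=
  ∑ p : Γ × (Fin M.cells → Δ),
    Finsupp.single (p.1, y.overwrite p.2) (M.S.1 p (γ, y.front M.cells))

end ProverMove

/-- A prover with private tape alphabet `Δ`: for every input `x`, a sequence of operations, where
`move x i` is the operation of the `(i+1)`-st turn of the prover. -/
structure Prover (α Γ Δ : Type) [Fintype Γ] [DecidableEq Γ] [Fintype Δ] [DecidableEq Δ] where
  blank : Δ
  move : List α → ℕ → ProverMove Γ Δ

namespace Prover

variable {α Γ Δ : Type} [Fintype Γ] [DecidableEq Γ] [Fintype Δ] [DecidableEq Δ]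

/-- The sets `S_i` of private tape contents that the strategy on input `x` can produce in `i`
turns from the blank tape, whatever symbols are in the communication cell. -/
def reach (P : Prover α Γ Δ) (x : List α) : ℕ → Set (PrivateTape Δ P.blank)
  | 0 => {PrivateTape.allBlank}
  | i + 1 => {y | ∃ z ∈ P.reach x i, ∃ σ τ : Γ, (P.move x i).onBasis σ z (τ, y) ≠ 0}

/-- Committed provers (with respect to the blank communication symbol `blankΓ`): on every input,
at each turn, `|#⟩|y⟩` is left unchanged for every `y` that the prover can have produced so
far. -/
def Committed (P : Prover α Γ Δ) (blankΓ : Γ) : Prop :=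
  ∀ (x : List α) (i : ℕ), ∀ y ∈ P.reach x i,
    (P.move x i).onBasis blankΓ y = Finsupp.single (blankΓ, y) 1

end Prover

/-! ### Computations of a QIP protocol -/

section Computation

variable {α Q Γ Δ : Type} [Fintype Q] [DecidableEq Q] [Fintype Γ] [DecidableEq Γ]
  [Fintype Δ] [DecidableEq Δ]

/-- Global configurations on input `x`: inner state, head position, content of the communication
cell, content of the private tape (with blank symbol `b`). -/
abbrev Config (Q Γ Δ : Type) {α : Type} (b : Δ) (x : List α) : Type :=
  Q × ZMod (x.length + 2) × Γ × PrivateTape Δ b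

/-- Superpositions of global configurations.  Computations start at a basis vector and every
operation maps basis vectors to finite combinations of basis vectors, so finite combinations
suffice. -/
abbrev Superposition (Q Γ Δ : Type) {α : Type} (b : Δ) (x : List α) : Type :=
  Config Q Γ Δ b x →₀ ℂ

/-- The squared norm of a superposition. -/
noncomputable def normSq {ι : Type} (Φ : ι →₀ ℂ) : ℝ := Φ.sum fun _ a => ‖a‖ ^ 2

open Classical in
/-- The orthogonal projection onto the span of the configurations whose inner state is in `A`. -/
noncomputable def project {b : Δ} {x : List α} (A : Set Q) (Φ : Superposition Q Γ Δ b x) :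
    Superposition Q Γ Δ b x :=
  Φ.filter fun c => c.1 ∈ A

/-- The verifier's operation `U_δ^x ⊗ I` on the global configuration space. -/
noncomputable def verifierOp (V : Verifier α Q Γ) (b : Δ) (x : List α) :
    Superposition Q Γ Δ b x →ₗ[ℂ] Superposition Q Γ Δ b x :=
  Finsupp.linearCombination ℂ fun c : Config Q Γ Δ b x =>
    ∑ v : Q × ZMod (x.length + 2) × Γ,
      Finsupp.single (v.1, v.2.1, v.2.2, c.2.2.2) (V.stepMatrix x v (c.1, c.2.1, c.2.2.1))

/-- The operation `I ⊗ U_{P,i+1}^x` of the `(i+1)`-st turn of the prover on the global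
configuration space. -/
noncomputable def proverOp (P : Prover α Γ Δ) (x : List α) (i : ℕ) :
    Superposition Q Γ Δ P.blank x →ₗ[ℂ] Superposition Q Γ Δ P.blank x :=
  Finsupp.linearCombination ℂ fun c : Config Q Γ Δ P.blank x =>
    ((P.move x i).onBasis c.2.2.1 c.2.2.2).sum fun p a =>
      Finsupp.single (c.1, c.2.1, p.1, p.2) a

/-- The initial configuration. -/
def initConfig (P : Prover α Γ Δ) (V : Verifier α Q Γ) (x : List α) :
    Config Q Γ Δ P.blank x :=
  (V.init, 0, V.blank, PrivateTape.allBlank)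

/-- The superposition `Φ_{2i}` from which the verifier's `(i+1)`-st step starts: a step of the
verifier, the projection onto non-halting configurations, and a turn of the prover alternate. -/
noncomputable def evenState (P : Prover α Γ Δ) (V : Verifier α Q Γ) (x : List α) :
    ℕ → Superposition Q Γ Δ P.blank x
  | 0 => Finsupp.single (initConfig P V x) 1
  | i + 1 => proverOp P x i (project V.non (verifierOp V P.blank x (evenState P V x i)))

/-- The superposition `Φ_{2i+1}`, after the verifier's `(i+1)`-st step and measurement. -/
noncomputable def oddState (P : Prover α Γ Δ) (V : Verifier α Q Γ) (x : List α) (i : ℕ) :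
    Superposition Q Γ Δ P.blank x :=
  project V.non (verifierOp V P.blank x (evenState P V x i))

/-- The probability that a one-way verifier accepts: it makes `|x| + 2` steps in all, and after
each of them it measures whether it is in an accepting, rejecting or non-halting state. -/
noncomputable def acceptProb (P : Prover α Γ Δ) (V : Verifier α Q Γ) (x : List α) : ℝ :=
  ∑ i ∈ Finset.range (x.length + 2),
    normSq (project V.acc (verifierOp V P.blank x (evenState P V x i)))

/-- The probability that a one-way verifier rejects. -/
noncomputable def rejectProb (P : Prover α Γ Δ) (V : Verifier α Q Γ) (x : List α) : ℝ :=
  ∑ i ∈ Finset.range (x.length + 2),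
    normSq (project V.rej (verifierOp V P.blank x (evenState P V x i)))

/-- A global computation path of a one-way verifier's protocol, given by the configurations
`ξ (2i)` and `ξ (2i+1)` met before and after the verifier's `(i+1)`-st step, for indices up
to `m`.  The last superposition of the computation is `Φ_{2(|x|+1)+1}`. -/
structure IsPath (P : Prover α Γ Δ) (V : Verifier α Q Γ) (x : List α) (m : ℕ)
    (ξ : ℕ → Config Q Γ Δ P.blank x) : Prop where
  le_length : m ≤ 2 * (x.length + 1) + 1
  start : ξ 0 = initConfig P V x
  verifier_step : ∀ i, 2 * i + 1 ≤ m →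
    project V.non (verifierOp V P.blank x (Finsupp.single (ξ (2 * i)) 1)) (ξ (2 * i + 1)) ≠ 0
  prover_step : ∀ i, 2 * i + 2 ≤ m →
    proverOp P x i (Finsupp.single (ξ (2 * i + 1)) 1) (ξ (2 * i + 2)) ≠ 0
  even_amplitude : ∀ i, 2 * i ≤ m → evenState P V x i (ξ (2 * i)) ≠ 0
  odd_amplitude : ∀ i, 2 * i + 1 ≤ m → oddState P V x i (ξ (2 * i + 1)) ≠ 0

open Classical in
/-- The number of query configurations along a path: non-halting configurations in which the
verifier has just written a non-blank symbol in the communication cell. -/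
noncomputable def queryCount (P : Prover α Γ Δ) (V : Verifier α Q Γ) (x : List α) (m : ℕ)
    (ξ : ℕ → Config Q Γ Δ P.blank x) : ℕ :=
  ((Finset.range (m + 1)).filter fun j =>
    Odd j ∧ (ξ j).1 ∈ V.non ∧ (ξ j).2.2.1 ≠ V.blank).card

/-- The protocol makes at most `k` interactions on input `x`. -/
def InteractionsLE (P : Prover α Γ Δ) (V : Verifier α Q Γ) (k : ℕ) (x : List α) : Prop :=
  ∀ (m : ℕ) (ξ : ℕ → Config Q Γ Δ P.blank x), IsPath P V x m ξ → queryCount P V x m ξ ≤ k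

end Computation

/-! ### Language classes -/

/-- The class `QIP^#_k(1qfa)`: the languages recognized with bounded error probability by
`k`-interaction bounded QIP systems `(P, V)` with committed provers and 1qfa verifiers. -/
def QIPSharp (α : Type) (k : ℕ) : Set (Language α) :=
  {L | ∃ (Q Γ : Type) (_ : Fintype Q) (_ : DecidableEq Q) (_ : Fintype Γ) (_ : DecidableEq Γ)
      (V : Verifier α Q Γ), V.WellFormed ∧ V.IsOneWay ∧
    ∃ (Δ : Type) (_ : Fintype Δ) (_ : DecidableEq Δ) (P : Prover α Γ Δ), P.Committed V.blank ∧
      -- bounded error: completeness, and soundness against every committed prover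
      (∃ ε : ℝ, 0 ≤ ε ∧ ε < 1 / 2 ∧
        (∀ x ∈ L, 1 - ε ≤ acceptProb P V x) ∧
        (∀ x ∉ L, ∀ (Δ' : Type) (_ : Fintype Δ') (_ : DecidableEq Δ') (P' : Prover α Γ Δ'),
          P'.Committed V.blank → 1 - ε ≤ rejectProb P' V x)) ∧
      -- at most `k` interactions
      (∀ x ∈ L, InteractionsLE P V k x) ∧
      (∀ x ∉ L, ∀ (Δ' : Type) (_ : Fintype Δ') (_ : DecidableEq Δ') (P' : Prover α Γ Δ'),
        P'.Committed V.blank → InteractionsLE P' V k x)}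

/-- The language of all binary strings that end in `0`. -/
def zeroLang : Language (Fin 2) := {w | ∃ x : List (Fin 2), w = x ++ [0]}

end QIP

set_option linter.unusedSectionVars false

namespace QIP

/-! ### Finitely supported superpositions in `ℓ²` -/

section EllTwo

variable {ι κ : Type}

/-! Suppose a protocol recognizes the language with error `ε`. Any word becomes a non-member after
appending `1`, and on non-members every committed prover is limited to one interaction. Test provers
that mark their private tape when answering show that a query component, however it is answered,
causes no further query while input letters are read (`tensorSym_mem_noQuery`). The vectors with
this property form a subspace `noQuery`, invariant under the non-halting evolution.

Against any committed prover the state therefore splits into a part that has never queried, which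
sits on the blank tape and whose vector `idleVec` depends only on the verifier and the word, and a
part whose query has been answered. Both hold the blank communication symbol as long as no query is
made, so the prover leaves them alone and they evolve by the matrices `idleMat`. The prover matters
only through newly answered queries, and their squared norm is at most the loss of squared norm of
the idle vector (`visState_succ_decomposition`, `visState_add_length_decomposition`).

Choose a word `w` after which this loss is negligible. From then on the evolution is, uniformly in
the prover, close to a fixed product of contractions. Recurrence of contractions in finite dimension
(`exists_wordMat_near`) yields `u` and `k ≥ 1` such that `u1` and `u10^k` have nearly equal
products. So under one and the same sequence of moves the states after `wu1` and `wu10^k` nearly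
agree (`exists_near_return`), and so do the acceptance probabilities (`acceptProb_append_le`).
Playing on `wu1` the honest strategy for `wu10^k` is again committed and violates soundness. -/

open Classical in
/-- The embedding of finitely supported superpositions into `ℓ²`. -/
noncomputable def ell2 (ι : Type) : (ι →₀ ℂ) →ₗ[ℂ] lp (fun _ : ι => ℂ) 2 :=
  Finsupp.linearCombination ℂ fun i => lp.single 2 i (1 : ℂ)

open Classical in
theorem ell2_single (i : ι) (a : ℂ) :
    ell2 ι (Finsupp.single i a) = lp.single 2 i a := by
  rw [ell2, Finsupp.linearCombination_single, ← lp.single_smul]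
  simp

theorem orthonormal_single : Orthonormal ℂ fun i : ι => ell2 ι (Finsupp.single i 1) := by
  classical
  rw [orthonormal_iff_ite]
  intro i j
  rw [ell2_single, ell2_single, lp.inner_single_left]
  simp [Pi.single_apply]

theorem normSq_linearCombination {E : Type*} [NormedAddCommGroup E] [InnerProductSpace ℂ E]
    {v : ι → E} (hv : Orthonormal ℂ v) (Φ : ι →₀ ℂ) :
    ‖Finsupp.linearCombination ℂ v Φ‖ ^ 2 = normSq Φ := by
  have h := hv.inner_finsupp_eq_sum_left Φ Φ
  rw [inner_self_eq_norm_sq_to_K] at h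
  have h2 : ((normSq Φ : ℝ) : ℂ) = Φ.sum fun i y => (starRingEnd ℂ) y * Φ i := by
    rw [normSq, Finsupp.sum, Finsupp.sum]
    push_cast
    refine Finset.sum_congr rfl fun i _ => ?_
    rw [Complex.conj_mul']
  rw [← h2] at h
  exact Complex.ofReal_injective (by rw [← h]; simp)

theorem norm_ell2_sq (Φ : ι →₀ ℂ) : ‖ell2 ι Φ‖ ^ 2 = normSq Φ := by
  classical
  rw [← normSq_linearCombination orthonormal_single Φ]
  congr 2
  conv_lhs => rw [ell2]
  simp only [ell2_single]

theorem normSq_nonneg (Φ : ι →₀ ℂ) : 0 ≤ normSq Φ := by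
  rw [← norm_ell2_sq]; positivity

/-- A linear map that sends the standard basis to an orthonormal family preserves the norm. -/
theorem normSq_map_of_orthonormal (T : (ι →₀ ℂ) →ₗ[ℂ] (κ →₀ ℂ))
    (hT : Orthonormal ℂ fun i => ell2 κ (T (Finsupp.single i 1))) (Φ : ι →₀ ℂ) :
    normSq (T Φ) = normSq Φ := by
  rw [← norm_ell2_sq, ← normSq_linearCombination hT Φ]
  congr 2
  have : (ell2 κ ∘ₗ T) =
      Finsupp.linearCombination ℂ fun i => ell2 κ (T (Finsupp.single i 1)) := by
    ext i : 2
    simp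
  exact LinearMap.congr_fun this Φ

theorem normSq_eq_sum (s : Finset ι) (Φ : ι →₀ ℂ) (hs : ∀ i ∉ s, Φ i = 0) :
    normSq Φ = ∑ i ∈ s, ‖Φ i‖ ^ 2 := by
  rw [normSq, Finsupp.sum_of_support_subset]
  · intro i hi
    by_contra h
    exact (Finsupp.mem_support_iff.1 hi) (hs i h)
  · simp

theorem normSq_add_of_disjoint (Φ Ψ : ι →₀ ℂ) (h : ∀ i, Φ i = 0 ∨ Ψ i = 0) :
    normSq (Φ + Ψ) = normSq Φ + normSq Ψ := by
  classical
  rw [normSq_eq_sum (Φ.support ∪ Ψ.support) (Φ + Ψ), normSq_eq_sum (Φ.support ∪ Ψ.support) Φ,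
    normSq_eq_sum (Φ.support ∪ Ψ.support) Ψ, ← Finset.sum_add_distrib]
  · refine Finset.sum_congr rfl fun i _ => ?_
    rcases h i with h | h <;> simp [h]
  all_goals intro i hi; simp at hi; simp [hi.1, hi.2]

theorem normSq_sub_le (Φ Ψ : ι →₀ ℂ) :
    normSq Φ - normSq Ψ ≤ ‖ell2 ι (Φ - Ψ)‖ * (‖ell2 ι Φ‖ + ‖ell2 ι Ψ‖) := by
  rw [← norm_ell2_sq, ← norm_ell2_sq, map_sub]
  have := norm_sub_norm_le (ell2 ι Φ) (ell2 ι Ψ)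
  nlinarith [norm_nonneg (ell2 ι Φ), norm_nonneg (ell2 ι Ψ)]

/-- Supplies the predecessor configuration when a computation path is traced backwards. -/
theorem exists_apply_single_ne_zero {T : (ι →₀ ℂ) →ₗ[ℂ] (κ →₀ ℂ)} {Φ : ι →₀ ℂ} {c : κ}
    (h : T Φ c ≠ 0) : ∃ i, Φ i ≠ 0 ∧ T (Finsupp.single i 1) c ≠ 0 := by
  by_contra! hn
  apply h
  have : T Φ = Φ.sum fun i a => a • T (Finsupp.single i 1) := by
    conv_lhs => rw [← Finsupp.sum_single Φ]
    rw [map_finsuppSum]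
    refine Finsupp.sum_congr fun i _ => ?_
    rw [← map_smul]
    simp
  rw [this, Finsupp.sum, Finsupp.finsetSum_apply]
  refine Finset.sum_eq_zero fun i hi => ?_
  rw [Finsupp.smul_apply, hn i (Finsupp.mem_support_iff.1 hi), smul_zero]

end EllTwo

/-! ### Operators on the visible part -/

section Act

variable {ι T : Type} [Fintype ι] [DecidableEq ι]

/-- The operator `M ⊗ I` on superpositions of pairs. -/
noncomputable def act (M : Matrix ι ι ℂ) : (ι × T →₀ ℂ) →ₗ[ℂ] (ι × T →₀ ℂ) :=
  Finsupp.linearCombination ℂ fun c => ∑ v : ι, Finsupp.single (v, c.2) (M v c.1)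

/-- The vector of amplitudes with second component `y`. -/
def slice (Φ : ι × T →₀ ℂ) (y : T) : ι → ℂ := fun v => Φ (v, y)

/-- The superposition `f ⊗ |y⟩`. -/
noncomputable def atTape (y : T) (f : ι → ℂ) : ι × T →₀ ℂ := ∑ v, Finsupp.single (v, y) (f v)

/-- The squared Euclidean norm of a vector. -/
noncomputable def vecNormSq {κ : Type} [Fintype κ] (f : κ → ℂ) : ℝ := ∑ v, ‖f v‖ ^ 2

theorem slice_add (Φ Ψ : ι × T →₀ ℂ) (y : T) : slice (Φ + Ψ) y = slice Φ y + slice Ψ y := rfl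

theorem atTape_apply [DecidableEq T] (y y' : T) (f : ι → ℂ) (v : ι) :
    atTape y f (v, y') = if y' = y then f v else 0 := by
  classical
  rw [atTape, Finsupp.finsetSum_apply]
  by_cases h : y' = y
  · subst h
    simp [Finsupp.single_apply]
  · rw [if_neg h]
    refine Finset.sum_eq_zero fun i _ => ?_
    rw [Finsupp.single_apply, if_neg]
    rintro ⟨⟩
    exact h rfl

theorem slice_atTape_self (y : T) (f : ι → ℂ) : slice (atTape y f) y = f := by
  classical
  funext v
  simp [slice, atTape_apply]

theorem slice_atTape_of_ne {y y' : T} (h : y' ≠ y) (f : ι → ℂ) : slice (atTape y f) y' = 0 := by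
  classical
  funext v
  simp [slice, atTape_apply, h]

theorem atTape_add (y : T) (f g : ι → ℂ) : atTape y (f + g) = atTape y f + atTape y g := by
  classical
  ext ⟨v, y'⟩
  simp only [atTape_apply, Finsupp.add_apply, Pi.add_apply]
  split_ifs <;> simp

theorem slice_act (M : Matrix ι ι ℂ) (Φ : ι × T →₀ ℂ) (y : T) :
    slice (act M Φ) y = M.mulVec (slice Φ y) := by
  classical
  induction Φ using Finsupp.induction_linear with
  | zero => funext v; simp [slice, Matrix.mulVec, dotProduct]
  | add f g hf hg => rw [map_add, slice_add, slice_add, hf, hg, Matrix.mulVec_add]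
  | single c a =>
    funext v
    simp only [slice, act, Finsupp.linearCombination_single, Finsupp.smul_apply,
      Finsupp.finsetSum_apply, Matrix.mulVec, dotProduct, smul_eq_mul]
    obtain ⟨u, z⟩ := c
    by_cases h : z = y
    · subst h
      simp [Finsupp.single_apply, mul_comm]
    · simp [h]

theorem act_apply (M : Matrix ι ι ℂ) (Φ : ι × T →₀ ℂ) (v : ι) (y : T) :
    act M Φ (v, y) = M.mulVec (slice Φ y) v := congrFun (slice_act M Φ y) v

theorem ext_slice {Φ Ψ : ι × T →₀ ℂ} (h : ∀ y, slice Φ y = slice Ψ y) : Φ = Ψ := by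
  ext ⟨v, y⟩
  exact congrFun (h y) v

theorem act_mul (M N : Matrix ι ι ℂ) (Φ : ι × T →₀ ℂ) : act (M * N) Φ = act M (act N Φ) :=
  ext_slice fun y => by simp [slice_act]

theorem act_one (Φ : ι × T →₀ ℂ) : act (1 : Matrix ι ι ℂ) Φ = Φ :=
  ext_slice fun y => by simp [slice_act]

theorem act_sub (M N : Matrix ι ι ℂ) (Φ : ι × T →₀ ℂ) : act (M - N) Φ = act M Φ - act N Φ :=
  ext_slice fun y => by
    rw [slice_act, Matrix.sub_mulVec, ← slice_act, ← slice_act]; rfl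

theorem act_add (M N : Matrix ι ι ℂ) (Φ : ι × T →₀ ℂ) : act (M + N) Φ = act M Φ + act N Φ :=
  ext_slice fun y => by
    rw [slice_act, Matrix.add_mulVec, ← slice_act, ← slice_act]; rfl

theorem act_atTape (M : Matrix ι ι ℂ) (y : T) (f : ι → ℂ) :
    act M (atTape y f) = atTape y (M.mulVec f) := by
  refine ext_slice fun y' => ?_
  rw [slice_act]
  by_cases h : y' = y
  · subst h; rw [slice_atTape_self, slice_atTape_self]
  · rw [slice_atTape_of_ne h, slice_atTape_of_ne h, Matrix.mulVec_zero]

theorem normSq_eq_sum_slice (s : Finset T) (Φ : ι × T →₀ ℂ) (hs : ∀ y ∉ s, slice Φ y = 0) :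
    normSq Φ = ∑ y ∈ s, vecNormSq (slice Φ y) := by
  rw [normSq_eq_sum (Finset.univ ×ˢ s), Finset.sum_product_right]
  · rfl
  · rintro ⟨v, y⟩ h
    exact congrFun (hs y (by simpa using h)) v

theorem normSq_atTape (y : T) (f : ι → ℂ) : normSq (atTape y f) = vecNormSq f := by
  rw [normSq_eq_sum_slice {y}]
  · simp [slice_atTape_self]
  · intro y' h
    exact slice_atTape_of_ne (by simpa using h) f

theorem exists_finset_slice (Φ : ι × T →₀ ℂ) : ∃ s : Finset T, ∀ y ∉ s, slice Φ y = 0 := by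
  classical
  refine ⟨Φ.support.image Prod.snd, fun y hy => ?_⟩
  funext v
  by_contra h
  exact hy (Finset.mem_image.2 ⟨(v, y), Finsupp.mem_support_iff.2 h, rfl⟩)

/-- `M ⊗ I` acts on the mutually orthogonal tape slices one by one. The constant does not depend on
the tape space `T`, which is what makes later estimates uniform in the prover. -/
theorem normSq_act_le {M : Matrix ι ι ℂ} {c : ℝ}
    (hM : ∀ f, vecNormSq (M.mulVec f) ≤ c * vecNormSq f) (Φ : ι × T →₀ ℂ) :
    normSq (act M Φ) ≤ c * normSq Φ := by
  obtain ⟨s, hs⟩ := exists_finset_slice Φ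
  rw [normSq_eq_sum_slice s Φ hs, normSq_eq_sum_slice s (act M Φ), Finset.mul_sum]
  · exact Finset.sum_le_sum fun y _ => by rw [slice_act]; exact hM _
  · intro y hy
    rw [slice_act, hs y hy, Matrix.mulVec_zero]

end Act

/-! ### Recurrence of contractions -/

section Recurrence

/-- Any `w` whose value is within `δ` of the infimum works. No monotonicity of `f` is needed. -/
theorem exists_forall_append_sub_le {α : Type} (f : List α → ℝ) (hf : ∀ w, 0 ≤ f w) {δ : ℝ}
    (hδ : 0 < δ) : ∃ w, ∀ u, f w - f (w ++ u) ≤ δ := by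
  have hb : BddBelow (Set.range f) := ⟨0, by rintro _ ⟨w, rfl⟩; exact hf w⟩
  obtain ⟨_, ⟨w, rfl⟩, hw⟩ := exists_lt_of_csInf_lt (Set.range_nonempty f)
    (lt_add_of_pos_right (sInf (Set.range f)) hδ)
  refine ⟨w, fun u => ?_⟩
  have := csInf_le hb ⟨w ++ u, rfl⟩
  linarith

/-- A contraction whose powers nearly preserve the norm of `X` has a positive power that nearly
fixes `X`. -/
theorem exists_pow_apply_near {E : Type*} [NormedAddCommGroup E] [InnerProductSpace ℂ E]
    [FiniteDimensional ℂ E] (G : E →ₗ[ℂ] E) (hG : ∀ z, ‖G z‖ ≤ ‖z‖) (X : E) {δ : ℝ} (hδ : 0 < δ)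
    (hX : ∀ k : ℕ, ‖X‖ ^ 2 - ‖(G ^ k) X‖ ^ 2 ≤ δ) :
    ∃ k : ℕ, 1 ≤ k ∧ ‖(G ^ k) X - X‖ ^ 2 ≤ 5 * δ := by
  have hpow : ∀ (k : ℕ) z, ‖(G ^ k) z‖ ≤ ‖z‖ := by
    intro k
    induction k with
    | zero => intro z; simp
    | succ k ih => intro z; rw [pow_succ']; exact (hG _).trans (ih z)
  have : ProperSpace E := FiniteDimensional.proper ℂ E
  -- The orbit of `X` stays in a compact ball, so two of its terms are within `√δ`. The difference
  -- of their exponents is the required power.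
  obtain ⟨L, -, φ, hφ, hL⟩ := tendsto_subseq_of_bounded
    (Metric.isBounded_closedBall (x := (0 : E)) (r := ‖X‖))
    (x := fun n => (G ^ n) X) (fun n => by simpa using hpow n X)
  have hc := hL.cauchySeq
  obtain ⟨N, hN⟩ := Metric.cauchySeq_iff.1 hc (Real.sqrt δ) (Real.sqrt_pos.2 hδ)
  have h1 := hN N le_rfl (N + 1) (Nat.le_succ N)
  have hlt : φ N < φ (N + 1) := hφ (Nat.lt_succ_self N)
  obtain ⟨k, hk⟩ := Nat.exists_eq_add_of_lt hlt
  refine ⟨k + 1, by omega, ?_⟩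
  set a := φ N
  set Y := (G ^ (k + 1)) X
  have hY : (G ^ a) Y = (G ^ (φ (N + 1))) X := by
    rw [hk, add_assoc, pow_add]; rfl
  have hclose : ‖(G ^ a) (Y - X)‖ ^ 2 ≤ δ := by
    rw [map_sub, hY, ← dist_eq_norm, dist_comm]
    have h2 : dist ((G ^ a) X) ((G ^ φ (N + 1)) X) < √δ := h1
    calc _ ≤ √δ ^ 2 := by gcongr
      _ = δ := Real.sq_sqrt hδ.le
  -- `G ^ a` lowers the squared norms of `X` and `Y` by at most `δ` each and does not increase that
  -- of `Y + X`. By the two parallelogram laws it lowers that of `Y - X` by at most `4 * δ`, and the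
  -- image has squared norm at most `δ`.
  have hp1 := parallelogram_law_with_norm ℂ Y X
  have hp2 := parallelogram_law_with_norm ℂ ((G ^ a) Y) ((G ^ a) X)
  rw [← map_add, ← map_sub] at hp2
  have h3 : ‖(G ^ a) (Y + X)‖ * ‖(G ^ a) (Y + X)‖ ≤ ‖Y + X‖ * ‖Y + X‖ :=
    mul_self_le_mul_self (norm_nonneg _) (hpow a _)
  have h4 := hX a
  have h5 : ‖Y‖ ^ 2 - ‖(G ^ a) Y‖ ^ 2 ≤ δ := by
    have := hX (φ (N + 1))
    rw [← hY] at this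
    have h6 : ‖Y‖ ^ 2 ≤ ‖X‖ ^ 2 := by gcongr; exact hpow _ _
    linarith
  nlinarith

/-! ### Products of contractions along words -/

/-- The product of the matrices of the letters of a word, the first letter acting first. -/
def wordMat {α ι : Type} [Fintype ι] [DecidableEq ι] (A : α → Matrix ι ι ℂ) :
    List α → Matrix ι ι ℂ
  | [] => 1
  | a :: w => wordMat A w * A a

variable {α ι : Type} [Fintype ι] [DecidableEq ι]

theorem wordMat_append (A : α → Matrix ι ι ℂ) (u v : List α) :
    wordMat A (u ++ v) = wordMat A v * wordMat A u := by
  induction u with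
  | nil => simp [wordMat]
  | cons a u ih => rw [List.cons_append, wordMat, wordMat, ih, Matrix.mul_assoc]

theorem wordMat_singleton (A : α → Matrix ι ι ℂ) (a : α) : wordMat A [a] = A a := by
  simp [wordMat]

theorem wordMat_replicate (A : α → Matrix ι ι ℂ) (a : α) (k : ℕ) :
    wordMat A (List.replicate k a) = A a ^ k := by
  induction k with
  | zero => simp [wordMat]
  | succ k ih => rw [List.replicate_succ, wordMat, ih, pow_succ]

theorem vecNormSq_nonneg (f : ι → ℂ) : 0 ≤ vecNormSq f :=
  Finset.sum_nonneg fun _ _ => by positivity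

/-- The squared Hilbert–Schmidt norm. -/
noncomputable def hsNormSq (M : Matrix ι ι ℂ) : ℝ := ∑ j, vecNormSq fun i => M i j

theorem hsNormSq_nonneg (M : Matrix ι ι ℂ) : 0 ≤ hsNormSq M :=
  Finset.sum_nonneg fun _ _ => vecNormSq_nonneg _

/-- Cauchy–Schwarz in each row. It turns closeness of two matrices in Hilbert–Schmidt norm into
closeness of their actions on every vector. -/
theorem vecNormSq_mulVec_le (M : Matrix ι ι ℂ) (f : ι → ℂ) :
    vecNormSq (M.mulVec f) ≤ hsNormSq M * vecNormSq f := by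
  have : hsNormSq M = ∑ i, ∑ j, ‖M i j‖ ^ 2 := by
    rw [hsNormSq, Finset.sum_comm']
    · rfl
    · simp
  rw [this, Finset.sum_mul]
  refine Finset.sum_le_sum fun i _ => ?_
  refine le_trans ?_ (Finset.sum_mul_sq_le_sq_mul_sq Finset.univ (fun j => ‖M i j‖) fun j => ‖f j‖)
  gcongr
  rw [Matrix.mulVec, dotProduct]
  exact (norm_sum_le _ _).trans_eq (Finset.sum_congr rfl fun j _ => norm_mul _ _)

/-- Matrices as vectors of a Euclidean space. -/
noncomputable def toHS : Matrix ι ι ℂ ≃ₗ[ℂ] EuclideanSpace ℂ (ι × ι) :=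
  (LinearEquiv.curry ℂ ℂ ι ι).symm ≪≫ₗ (WithLp.linearEquiv 2 ℂ (ι × ι → ℂ)).symm

theorem norm_toHS_sq (M : Matrix ι ι ℂ) : ‖toHS M‖ ^ 2 = hsNormSq M := by
  rw [EuclideanSpace.norm_sq_eq, Fintype.sum_prod_type_right]
  rfl

theorem hsNormSq_mul_le {A : Matrix ι ι ℂ} (hA : ∀ f, vecNormSq (A.mulVec f) ≤ vecNormSq f)
    (M : Matrix ι ι ℂ) : hsNormSq (A * M) ≤ hsNormSq M :=
  Finset.sum_le_sum fun j _ => hA fun i => M i j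

/-- Left multiplication by `A a` is a contraction of the Hilbert–Schmidt space. If the norm of the
product along `u` is nearly minimal among continuations of `u`, powers of this contraction nearly
preserve the norm of the product along `ub`, and recurrence applies to that product as a vector. The
letter `b` is inserted so that the shorter word has a prescribed last letter. -/
theorem exists_wordMat_near (A : α → Matrix ι ι ℂ)
    (hA : ∀ a f, vecNormSq ((A a).mulVec f) ≤ vecNormSq f) (a b : α) {δ : ℝ} (hδ : 0 < δ) :
    ∃ (u : List α) (k : ℕ), 1 ≤ k ∧
      hsNormSq (wordMat A (u ++ [b] ++ List.replicate k a) - wordMat A (u ++ [b])) ≤ δ := by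
  -- The division by 5 cancels the factor in `exists_pow_apply_near`.
  obtain ⟨u, hu⟩ := exists_forall_append_sub_le (fun u => hsNormSq (wordMat A u))
    (fun u => hsNormSq_nonneg _) (δ := δ / 5) (by positivity)
  let G : EuclideanSpace ℂ (ι × ι) →ₗ[ℂ] EuclideanSpace ℂ (ι × ι) :=
    toHS.toLinearMap ∘ₗ LinearMap.mulLeft ℂ (A a) ∘ₗ toHS.symm.toLinearMap
  have hGM : ∀ M, G (toHS M) = toHS (A a * M) := fun M => by simp [G]
  have hG : ∀ z, ‖G z‖ ≤ ‖z‖ := by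
    intro z
    obtain ⟨M, rfl⟩ := toHS.surjective z
    rw [hGM]
    refine le_of_sq_le_sq ?_ (norm_nonneg _)
    rw [norm_toHS_sq, norm_toHS_sq]
    exact hsNormSq_mul_le (hA a) M
  have hGk : ∀ k, (G ^ k) (toHS (wordMat A (u ++ [b]))) =
      toHS (wordMat A (u ++ [b] ++ List.replicate k a)) := by
    intro k
    rw [wordMat_append _ (u ++ [b]), wordMat_replicate]
    induction k with
    | zero => simp
    | succ k ih => rw [pow_succ', Module.End.mul_apply, ih, hGM, pow_succ', Matrix.mul_assoc]
  obtain ⟨k, hk, h⟩ := exists_pow_apply_near G hG (toHS (wordMat A (u ++ [b]))) (δ := δ / 5)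
    (by positivity) (by
      intro k
      rw [hGk, norm_toHS_sq, norm_toHS_sq]
      have h1 := hu ([b] ++ List.replicate k a)
      have h2 : hsNormSq (wordMat A (u ++ [b])) ≤ hsNormSq (wordMat A u) := by
        rw [wordMat_append, wordMat_singleton]
        exact hsNormSq_mul_le (hA b) _
      rw [← List.append_assoc] at h1
      linarith)
  refine ⟨u, k, hk, ?_⟩
  rw [hGk, ← map_sub, norm_toHS_sq] at h
  linarith

end Recurrence

/-! ### Prover moves as isometries -/

section ProverAct

variable {Q Γ Δ : Type} [Fintype Γ] [DecidableEq Γ] [Fintype Δ] [DecidableEq Δ] {b : Δ}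

open Classical in
theorem inner_ell2_single (i j : Q) (a c : ℂ) :
    inner ℂ (ell2 Q (Finsupp.single i a)) (ell2 Q (Finsupp.single j c)) =
      if i = j then (starRingEnd ℂ) a * c else 0 := by
  rw [ell2_single, ell2_single, lp.inner_single_left]
  by_cases h : i = j
  · subst h; simp [mul_comm]
  · simp [h]

/-- The operation of a prover on superpositions of triples (inner state, communication symbol,
private tape). -/
noncomputable def proverAct (M : ProverMove Γ Δ) :
    ((Q × Γ) × PrivateTape Δ b →₀ ℂ) →ₗ[ℂ] ((Q × Γ) × PrivateTape Δ b →₀ ℂ) :=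
  Finsupp.linearCombination ℂ fun c =>
    (M.onBasis c.1.2 c.2).sum fun p a => Finsupp.single ((c.1.1, p.1), p.2) a

theorem proverAct_single (M : ProverMove Γ Δ) (q : Q) (γ : Γ) (y : PrivateTape Δ b) :
    proverAct M (Finsupp.single ((q, γ), y) 1) =
      ∑ p : Γ × (Fin M.cells → Δ),
        Finsupp.single ((q, p.1), y.overwrite p.2) (M.S.1 p (γ, y.front M.cells)) := by
  rw [proverAct, Finsupp.linearCombination_single, one_smul, ProverMove.onBasis,
    ← Finsupp.sum_finsetSum_index (by simp) (by intros; simp)]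
  simp

theorem proverAct_single_of_onBasis {M : ProverMove Γ Δ} {γ γ' : Γ} {y y' : PrivateTape Δ b}
    (h : M.onBasis γ y = Finsupp.single (γ', y') 1) (q : Q) :
    proverAct M (Finsupp.single ((q, γ), y) 1) = Finsupp.single ((q, γ'), y') 1 := by
  rw [proverAct, Finsupp.linearCombination_single, one_smul]
  simp [h]

theorem PrivateTape.overwrite_inj {m : ℕ} {y y' : PrivateTape Δ b} {u u' : Fin m → Δ}
    (h : ∀ i, m ≤ i → y.1 i = y'.1 i) : y.overwrite u = y'.overwrite u' ↔ u = u' := by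
  constructor
  · intro heq
    funext i
    have := congrFun (congrArg Subtype.val heq) i
    simpa [overwrite] using this
  · rintro rfl
    apply Subtype.ext
    funext i
    by_cases hi : i < m
    · simp [overwrite, hi]
    · simp [overwrite, hi, h i (not_lt.1 hi)]

theorem PrivateTape.eq_of_overwrite_eq {m : ℕ} {y y' : PrivateTape Δ b} {u u' : Fin m → Δ}
    (heq : y.overwrite u = y'.overwrite u') : ∀ i, m ≤ i → y.1 i = y'.1 i := by
  intro i hi
  have := congrFun (congrArg Subtype.val heq) i
  simpa [overwrite, not_lt.2 hi] using this

/-- If two tapes agree beyond the first `M.cells` cells and the inner states agree, the inner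
product is one of columns of the unitary `M.S`. Otherwise the two images have disjoint supports. -/
theorem orthonormal_proverAct (M : ProverMove Γ Δ) :
    Orthonormal ℂ fun c : (Q × Γ) × PrivateTape Δ b =>
      ell2 _ (proverAct M (Finsupp.single c 1)) := by
  classical
  rw [orthonormal_iff_ite]
  rintro ⟨⟨q, γ⟩, y⟩ ⟨⟨q', γ'⟩, y'⟩
  rw [proverAct_single, proverAct_single, map_sum, map_sum, sum_inner]
  simp only [inner_sum, inner_ell2_single, Prod.mk.injEq]
  by_cases h : q = q' ∧ ∀ i, M.cells ≤ i → y.1 i = y'.1 i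
  · obtain ⟨rfl, h⟩ := h
    have hU := congrFun (congrFun (Matrix.mem_unitaryGroup_iff'.1 M.S.2)
      (γ, y.front M.cells)) (γ', y'.front M.cells)
    rw [Matrix.mul_apply, Matrix.one_apply] at hU
    have h1 : (γ, y.front M.cells) = (γ', y'.front M.cells) ↔ (q = q ∧ γ = γ') ∧ y = y' := by
      rw [Prod.mk.injEq, eq_self, true_and]
      refine and_congr_right fun _ => ⟨fun hf => ?_, fun hf => by rw [hf]⟩
      apply Subtype.ext
      funext i
      by_cases hi : i < M.cells
      · exact congrFun hf ⟨i, hi⟩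
      · exact h i (not_lt.1 hi)
    refine Eq.trans ?_ (hU.trans (if_congr h1 rfl rfl))
    refine Finset.sum_congr rfl fun p _ => ?_
    rw [Finset.sum_eq_single p]
    · simp [Matrix.star_apply, (PrivateTape.overwrite_inj h).2 rfl]
    · intro p' _ hp
      rw [if_neg]
      rw [PrivateTape.overwrite_inj h]
      rintro ⟨⟨-, h1⟩, h2⟩
      exact hp (Prod.ext h1.symm h2.symm)
    · simp
  · have h1 : ¬ ((q = q' ∧ γ = γ') ∧ y = y') := by
      rintro ⟨⟨rfl, -⟩, rfl⟩
      exact h ⟨rfl, fun _ _ => rfl⟩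
    rw [if_neg h1]
    refine Finset.sum_eq_zero fun p _ => Finset.sum_eq_zero fun p' _ => if_neg ?_
    rintro ⟨⟨hq, -⟩, hy⟩
    exact h ⟨hq, PrivateTape.eq_of_overwrite_eq hy⟩

theorem normSq_proverAct (M : ProverMove Γ Δ) (Φ : (Q × Γ) × PrivateTape Δ b →₀ ℂ) :
    normSq (proverAct M Φ) = normSq Φ :=
  normSq_map_of_orthonormal _ (orthonormal_proverAct M) Φ

theorem proverAct_eq_self {M : ProverMove Γ Δ} {Φ : (Q × Γ) × PrivateTape Δ b →₀ ℂ}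
    (h : ∀ q γ y, Φ ((q, γ), y) ≠ 0 → M.onBasis γ y = Finsupp.single (γ, y) 1) :
    proverAct M Φ = Φ := by
  conv_lhs => rw [← Finsupp.sum_single Φ]
  conv_rhs => rw [← Finsupp.sum_single Φ]
  rw [map_finsuppSum]
  refine Finsupp.sum_congr ?_
  rintro ⟨⟨q, γ⟩, y⟩ hc
  rw [← mul_one (Φ ((q, γ), y)), ← smul_eq_mul, ← Finsupp.smul_single, map_smul,
    proverAct_single_of_onBasis (h q γ y (Finsupp.mem_support_iff.1 hc))]

theorem proverAct_apply_single (M : ProverMove Γ Δ) (q q' : Q) (γ γ' : Γ)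
    (y y' : PrivateTape Δ b) [DecidableEq Q] :
    proverAct M (Finsupp.single ((q, γ), y) 1) ((q', γ'), y') =
      if q = q' then M.onBasis γ y (γ', y') else 0 := by
  classical
  rw [proverAct_single, ProverMove.onBasis, Finsupp.finsetSum_apply, Finsupp.finsetSum_apply]
  by_cases h : q = q'
  · simp [h, Finsupp.single_apply]
  · simp [h]

/-- The vector `φ ⊗ |γ⟩`. -/
def tensorSym (φ : Q → ℂ) (γ : Γ) : Q × Γ → ℂ := fun v => if v.2 = γ then φ v.1 else 0

theorem slice_proverAct_atTape [Fintype Q] (M : ProverMove Γ Δ) (y y' : PrivateTape Δ b)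
    (f : Q × Γ → ℂ) :
    slice (proverAct M (atTape y f)) y' =
      ∑ γ, ∑ γ', M.onBasis γ y (γ', y') • tensorSym (fun q => f (q, γ)) γ' := by
  classical
  have h : proverAct M (atTape y f) =
      ∑ q, ∑ γ, f (q, γ) • proverAct M (Finsupp.single ((q, γ), y) 1) := by
    rw [atTape, map_sum, Fintype.sum_prod_type]
    refine Finset.sum_congr rfl fun q _ => Finset.sum_congr rfl fun γ _ => ?_
    rw [← map_smul, Finsupp.smul_single, smul_eq_mul, mul_one]
  funext ⟨q, γ'⟩
  rw [h]
  simp only [slice, Finsupp.finsetSum_apply, Finsupp.smul_apply, proverAct_apply_single,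
    Finset.sum_apply, Pi.smul_apply, tensorSym, smul_eq_mul, mul_ite, mul_zero]
  rw [Finset.sum_comm]
  refine Finset.sum_congr rfl fun γ _ => ?_
  simp [mul_comm]

/-! ### Reachable tapes and committed sequences of moves -/

/-- The sets of private tape contents that a sequence of moves can produce. -/
def reachSet (b : Δ) (mv : ℕ → ProverMove Γ Δ) : ℕ → Set (PrivateTape Δ b)
  | 0 => {PrivateTape.allBlank}
  | i + 1 => {y | ∃ z ∈ reachSet b mv i, ∃ σ τ : Γ, (mv i).onBasis σ z (τ, y) ≠ 0}

/-- Sequences of moves that leave the blank communication symbol `blankΓ` unanswered. -/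
def CommittedMoves (b : Δ) (blankΓ : Γ) (mv : ℕ → ProverMove Γ Δ) : Prop :=
  ∀ i, ∀ y ∈ reachSet b mv i, (mv i).onBasis blankΓ y = Finsupp.single (blankΓ, y) 1

theorem reach_eq_reachSet {α : Type} (P : Prover α Γ Δ) (x : List α) (i : ℕ) :
    P.reach x i = reachSet P.blank (P.move x) i := by
  induction i with
  | zero => rfl
  | succ i ih => rw [Prover.reach, reachSet, ih]

theorem committed_iff {α : Type} (P : Prover α Γ Δ) (blankΓ : Γ) :
    P.Committed blankΓ ↔ ∀ x, CommittedMoves P.blank blankΓ (P.move x) := by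
  simp only [Prover.Committed, CommittedMoves, reach_eq_reachSet]

theorem mem_reachSet_proverAct {mv : ℕ → ProverMove Γ Δ} {i : ℕ}
    {Φ : (Q × Γ) × PrivateTape Δ b →₀ ℂ} (h : ∀ y, slice Φ y ≠ 0 → y ∈ reachSet b mv i)
    {y : PrivateTape Δ b} (hy : slice (proverAct (mv i) Φ) y ≠ 0) :
    y ∈ reachSet b mv (i + 1) := by
  classical
  obtain ⟨⟨q, γ⟩, hne⟩ := Function.ne_iff.1 hy
  obtain ⟨⟨⟨q', γ'⟩, z⟩, h1, h2⟩ := exists_apply_single_ne_zero hne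
  refine ⟨z, h z fun h0 => h1 (congrFun h0 (q', γ')), γ', γ, ?_⟩
  rw [proverAct_apply_single] at h2
  exact fun h0 => h2 (by simp [h0])

theorem allBlank_mem_reachSet {blankΓ : Γ} {mv : ℕ → ProverMove Γ Δ}
    (h : CommittedMoves b blankΓ mv) (i : ℕ) : PrivateTape.allBlank ∈ reachSet b mv i := by
  induction i with
  | zero => rfl
  | succ i ih => exact ⟨_, ih, blankΓ, blankΓ, by simp [h i _ ih]⟩

/-- A blank symbol leaves the tape as it is, so the reachable sets increase. Components that stay
idle for several turns thus keep tapes to which the commitment applies. -/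
theorem mem_reachSet_succ {blankΓ : Γ} {mv : ℕ → ProverMove Γ Δ}
    (h : CommittedMoves b blankΓ mv) {i : ℕ} {y : PrivateTape Δ b} (hy : y ∈ reachSet b mv i) :
    y ∈ reachSet b mv (i + 1) :=
  ⟨_, hy, blankΓ, blankΓ, by simp [h i _ hy]⟩

end ProverAct

/-! ### The computation without head positions -/

namespace Verifier

variable {α Q Γ : Type}

/-- The transition matrix on pairs (inner state, communication symbol) for a scanned symbol. -/
def amp (V : Verifier α Q Γ) (σ : TapeSymbol α) : Matrix (Q × Γ) (Q × Γ) ℂ :=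
  fun v' v => V.δ v.1 σ v.2 v'.1 v'.2 1

open Classical in
/-- The transition matrix followed by the projection onto the span of `A`. -/
noncomputable def ampOn (V : Verifier α Q Γ) (A : Set (Q × Γ)) (σ : TapeSymbol α) :
    Matrix (Q × Γ) (Q × Γ) ℂ :=
  fun v' v => if v' ∈ A then V.amp σ v' v else 0

/-- The pairs whose inner state lies in `A`. -/
def onState (A : Set Q) : Set (Q × Γ) := {v | v.1 ∈ A}

/-- The non-halting pairs with a blank communication symbol. -/
def idle (V : Verifier α Q Γ) : Set (Q × Γ) := {v | v.1 ∈ V.non ∧ v.2 = V.blank}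

/-- The non-halting pairs with a non-blank communication symbol. -/
def query (V : Verifier α Q Γ) : Set (Q × Γ) := {v | v.1 ∈ V.non ∧ v.2 ≠ V.blank}

theorem stepMatrix_of_isOneWay {V : Verifier α Q Γ} (hV : V.IsOneWay) (x : List α)
    (c' c : Q × ZMod (x.length + 2) × Γ) :
    V.stepMatrix x c' c = if c'.2.1 = c.2.1 + 1 then
      V.amp (symbolAt x c.2.1) (c'.1, c'.2.2) (c.1, c.2.2) else 0 := by
  rw [stepMatrix, Finset.sum_eq_single 1]
  · rw [amp, SignType.coe_one]
  · intro d _ hd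
    rw [hV _ _ _ _ _ d hd, ite_self]
  · simp

variable [Fintype Q] [DecidableEq Q] [Fintype Γ] [DecidableEq Γ]

open Classical in
theorem ampOn_mulVec (V : Verifier α Q Γ) (A : Set (Q × Γ)) (σ : TapeSymbol α)
    (f : Q × Γ → ℂ) (v : Q × Γ) :
    (V.ampOn A σ).mulVec f v = if v ∈ A then (V.amp σ).mulVec f v else 0 := by
  by_cases h : v ∈ A <;> simp [Matrix.mulVec, dotProduct, ampOn, h]

/-- The columns of the step matrix with head on cell `k` are supported on the rows with head on cell
`k + 1`, so their orthonormality is that of the columns of this block. -/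
theorem amp_symbolAt {V : Verifier α Q Γ} (hW : V.WellFormed) (hV : V.IsOneWay) (x : List α)
    (k : ZMod (x.length + 2)) :
    V.amp (symbolAt x k) ∈ Matrix.unitaryGroup (Q × Γ) ℂ := by
  rw [Matrix.mem_unitaryGroup_iff']
  ext ⟨q, γ⟩ ⟨q', γ'⟩
  have h := congrFun (congrFun (Matrix.mem_unitaryGroup_iff'.1 (hW x)) (q, k, γ)) (q', k, γ')
  rw [Matrix.mul_apply] at h ⊢
  simp only [Matrix.star_apply, stepMatrix_of_isOneWay hV, Fintype.sum_prod_type] at h ⊢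
  have h1 : ((1 : Matrix (Q × Γ) (Q × Γ) ℂ) (q, γ) (q', γ')) =
      (1 : Matrix (Q × ZMod (x.length + 2) × Γ) _ ℂ) (q, k, γ) (q', k, γ') := by
    simp [Matrix.one_apply]
  rw [h1, ← h]
  refine Finset.sum_congr rfl fun q₁ _ => ?_
  rw [Finset.sum_eq_single (k + 1)]
  · simp
  · intro k' _ hk
    simp [hk]
  · simp

/-- Inputs of length at most one already exhibit every tape symbol: cell 1 is a letter on a
one-letter input and the right endmarker on the empty input. -/
theorem amp_mem_unitaryGroup {V : Verifier α Q Γ} (hW : V.WellFormed) (hV : V.IsOneWay)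
    (σ : TapeSymbol α) : V.amp σ ∈ Matrix.unitaryGroup (Q × Γ) ℂ := by
  cases σ with
  | cent => exact amp_symbolAt hW hV [] 0
  | sym a => exact amp_symbolAt hW hV [a] (1 : ZMod 3)
  | dollar => exact amp_symbolAt hW hV [] (1 : ZMod 2)

theorem vecNormSq_unitary {ι : Type} [Fintype ι] [DecidableEq ι] {M : Matrix ι ι ℂ}
    (hM : M ∈ Matrix.unitaryGroup ι ℂ) (f : ι → ℂ) : vecNormSq (M.mulVec f) = vecNormSq f := by
  have h : ∀ g : ι → ℂ, ((vecNormSq g : ℝ) : ℂ) = dotProduct (star g) g := by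
    intro g
    rw [vecNormSq, dotProduct]
    push_cast
    exact Finset.sum_congr rfl fun i _ => (Complex.conj_mul' _).symm
  apply Complex.ofReal_injective
  rw [h, h, Matrix.star_mulVec, Matrix.dotProduct_mulVec, Matrix.vecMul_vecMul,
    ← Matrix.star_eq_conjTranspose, Matrix.mem_unitaryGroup_iff'.1 hM, Matrix.vecMul_one]

theorem vecNormSq_ampOn_add_le {V : Verifier α Q Γ} (hW : V.WellFormed) (hV : V.IsOneWay)
    {A B : Set (Q × Γ)} (hAB : Disjoint A B) (σ : TapeSymbol α) (f : Q × Γ → ℂ) :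
    vecNormSq ((V.ampOn A σ).mulVec f) + vecNormSq ((V.ampOn B σ).mulVec f) ≤ vecNormSq f := by
  classical
  rw [← vecNormSq_unitary (amp_mem_unitaryGroup hW hV σ) f, vecNormSq, vecNormSq, vecNormSq,
    ← Finset.sum_add_distrib]
  refine Finset.sum_le_sum fun v _ => ?_
  rw [ampOn_mulVec, ampOn_mulVec]
  by_cases hA : v ∈ A
  · have hB : v ∉ B := Set.disjoint_left.1 hAB hA
    simp [hA, hB]
  · by_cases hB : v ∈ B <;> simp [hA, hB]

theorem vecNormSq_ampOn_le {V : Verifier α Q Γ} (hW : V.WellFormed) (hV : V.IsOneWay)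
    (A : Set (Q × Γ)) (σ : TapeSymbol α) (f : Q × Γ → ℂ) :
    vecNormSq ((V.ampOn A σ).mulVec f) ≤ vecNormSq f := by
  have := vecNormSq_ampOn_add_le hW hV (disjoint_bot_right (a := A)) σ f
  linarith [vecNormSq_nonneg ((V.ampOn ⊥ σ).mulVec f)]

theorem normSq_act_ampOn_le {V : Verifier α Q Γ} (hW : V.WellFormed) (hV : V.IsOneWay)
    (A : Set (Q × Γ)) (σ : TapeSymbol α) {T : Type} (Φ : (Q × Γ) × T →₀ ℂ) :
    normSq (act (V.ampOn A σ) Φ) ≤ normSq Φ := by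
  simpa using normSq_act_le (c := 1) (fun f => by simpa using vecNormSq_ampOn_le hW hV A σ f) Φ

theorem normSq_act_ampOn_add_le {V : Verifier α Q Γ} (hW : V.WellFormed) (hV : V.IsOneWay)
    {A B : Set (Q × Γ)} (hAB : Disjoint A B) (σ : TapeSymbol α) {T : Type}
    (Φ : (Q × Γ) × T →₀ ℂ) :
    normSq (act (V.ampOn A σ) Φ) + normSq (act (V.ampOn B σ) Φ) ≤ normSq Φ := by
  obtain ⟨s, hs⟩ := exists_finset_slice Φ
  have h : ∀ M : Matrix (Q × Γ) (Q × Γ) ℂ, ∀ y ∉ s, slice (act M Φ) y = 0 := by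
    intro M y hy
    rw [slice_act, hs y hy, Matrix.mulVec_zero]
  rw [normSq_eq_sum_slice s Φ hs, normSq_eq_sum_slice s _ (h _), normSq_eq_sum_slice s _ (h _),
    ← Finset.sum_add_distrib]
  refine Finset.sum_le_sum fun y _ => ?_
  rw [slice_act, slice_act]
  exact vecNormSq_ampOn_add_le hW hV hAB σ _

theorem ampOn_non (V : Verifier α Q Γ) (σ : TapeSymbol α) :
    V.ampOn (onState V.non) σ = V.ampOn V.idle σ + V.ampOn V.query σ := by
  ext v' v
  rw [Matrix.add_apply]
  by_cases h : v'.1 ∈ V.non <;> by_cases h2 : v'.2 = V.blank <;>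
    simp [ampOn, onState, idle, query, h, h2]

theorem disjoint_idle_query (V : Verifier α Q Γ) : Disjoint V.idle V.query :=
  Set.disjoint_left.2 fun _ h h' => h'.2 h.2

end Verifier

/-! ### Removing the head position from the superpositions -/

section Positions

variable {α Q Γ Δ : Type} [Fintype Q] [DecidableEq Q] [Fintype Γ] [DecidableEq Γ]
  [Fintype Δ] [DecidableEq Δ]

/-- The superposition before step `t` of the verifier, for a sequence of prover moves and a
sequence of scanned symbols, without head positions. -/
noncomputable def visState (V : Verifier α Q Γ) (b : Δ) (mv : ℕ → ProverMove Γ Δ)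
    (s : ℕ → TapeSymbol α) : ℕ → ((Q × Γ) × PrivateTape Δ b →₀ ℂ)
  | 0 => Finsupp.single ((V.init, V.blank), PrivateTape.allBlank) 1
  | t + 1 => proverAct (mv t) (act (V.ampOn (Verifier.onState V.non) (s t)) (visState V b mv s t))

theorem visState_congr (V : Verifier α Q Γ) (b : Δ) (mv : ℕ → ProverMove Γ Δ)
    {s s' : ℕ → TapeSymbol α} {t : ℕ} (h : ∀ i < t, s i = s' i) :
    visState V b mv s t = visState V b mv s' t := by
  induction t with
  | zero => rfl
  | succ t ih => rw [visState, visState, ih fun i hi => h i (by omega), h t (by omega)]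

/-- The symbols scanned by a one-way verifier on input `x`. -/
def symSeq (x : List α) (t : ℕ) : TapeSymbol α := symbolAt x t

/-- Put the head on cell `k`. -/
noncomputable def atCell {b : Δ} {x : List α} (k : ZMod (x.length + 2)) :
    ((Q × Γ) × PrivateTape Δ b →₀ ℂ) →ₗ[ℂ] Superposition Q Γ Δ b x :=
  Finsupp.lmapDomain ℂ ℂ fun c => (c.1.1, k, c.1.2, c.2)

theorem atCell_injective {b : Δ} {x : List α} (k : ZMod (x.length + 2)) :
    Function.Injective fun c : (Q × Γ) × PrivateTape Δ b => (c.1.1, k, c.1.2, c.2) := by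
  rintro ⟨⟨q, γ⟩, y⟩ ⟨⟨q', γ'⟩, y'⟩ h
  simp only [Prod.mk.injEq, true_and] at h
  simp [h]

theorem normSq_atCell {b : Δ} {x : List α} (k : ZMod (x.length + 2))
    (Φ : (Q × Γ) × PrivateTape Δ b →₀ ℂ) : normSq (atCell (x := x) k Φ) = normSq Φ := by
  rw [atCell, Finsupp.lmapDomain_apply, normSq,
    Finsupp.sum_mapDomain_index_inj (atCell_injective k), normSq]

theorem atCell_apply {b : Δ} {x : List α} (k k' : ZMod (x.length + 2))
    (Φ : (Q × Γ) × PrivateTape Δ b →₀ ℂ) (q : Q) (γ : Γ) (y : PrivateTape Δ b) :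
    atCell (x := x) k Φ (q, k', γ, y) = if k' = k then Φ ((q, γ), y) else 0 := by
  rw [atCell, Finsupp.lmapDomain_apply]
  by_cases h : k' = k
  · subst h
    rw [if_pos rfl]
    exact Finsupp.mapDomain_apply (atCell_injective k') Φ ((q, γ), y)
  · rw [if_neg h, Finsupp.mapDomain_of_notMem_range]
    rintro ⟨c, hc⟩
    simp only [Prod.mk.injEq] at hc
    exact h hc.2.1.symm

open Classical in
theorem project_apply {b : Δ} {x : List α} (A : Set Q) (Φ : Superposition Q Γ Δ b x)
    (c : Config Q Γ Δ b x) : project A Φ c = if c.1 ∈ A then Φ c else 0 := by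
  rw [project, Finsupp.filter_apply]

theorem verifierOp_atCell {V : Verifier α Q Γ} (hV : V.IsOneWay) {b : Δ} {x : List α}
    (k : ZMod (x.length + 2)) (Φ : (Q × Γ) × PrivateTape Δ b →₀ ℂ) :
    verifierOp V b x (atCell k Φ) = atCell (k + 1) (act (V.amp (symbolAt x k)) Φ) := by
  classical
  induction Φ using Finsupp.induction_linear with
  | zero => simp
  | add f g hf hg => simp only [map_add, hf, hg]
  | single c a =>
    obtain ⟨⟨q, γ⟩, y⟩ := c
    have h : atCell (x := x) k (Finsupp.single ((q, γ), y) a) =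
        Finsupp.single (q, k, γ, y) a := by
      rw [atCell, Finsupp.lmapDomain_apply, Finsupp.mapDomain_single]
    rw [h, verifierOp, act, Finsupp.linearCombination_single, Finsupp.linearCombination_single,
      map_smul, map_sum]
    congr 1
    rw [Fintype.sum_prod_type, Fintype.sum_prod_type]
    refine Finset.sum_congr rfl fun q' _ => ?_
    rw [Fintype.sum_prod_type, Finset.sum_eq_single (k + 1)]
    · refine Finset.sum_congr rfl fun γ' _ => ?_
      rw [atCell, Finsupp.lmapDomain_apply, Finsupp.mapDomain_single,
        Verifier.stepMatrix_of_isOneWay hV, if_pos rfl]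
    · intro k' _ hk
      refine Finset.sum_eq_zero fun γ' _ => ?_
      rw [Verifier.stepMatrix_of_isOneWay hV, if_neg hk, Finsupp.single_zero]
    · simp

theorem project_verifierOp_atCell {V : Verifier α Q Γ} (hV : V.IsOneWay) {b : Δ} {x : List α}
    (A : Set Q) (k : ZMod (x.length + 2)) (Φ : (Q × Γ) × PrivateTape Δ b →₀ ℂ) :
    project A (verifierOp V b x (atCell k Φ)) =
      atCell (k + 1) (act (V.ampOn (Verifier.onState A) (symbolAt x k)) Φ) := by
  classical
  ext ⟨q, k', γ, y⟩
  rw [project_apply, verifierOp_atCell hV, atCell_apply, atCell_apply, act_apply, act_apply,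
    Verifier.ampOn_mulVec]
  by_cases h : q ∈ A <;> simp [Verifier.onState, h]

theorem proverOp_atCell (P : Prover α Γ Δ) (x : List α) (i : ℕ) (k : ZMod (x.length + 2))
    (Φ : (Q × Γ) × PrivateTape Δ P.blank →₀ ℂ) :
    proverOp P x i (atCell k Φ) = atCell k (proverAct (P.move x i) Φ) := by
  induction Φ using Finsupp.induction_linear with
  | zero => simp
  | add f g hf hg => simp only [map_add, hf, hg]
  | single c a =>
    rw [atCell, Finsupp.lmapDomain_apply, Finsupp.mapDomain_single, proverOp, proverAct,
      Finsupp.linearCombination_single, Finsupp.linearCombination_single, map_smul,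
      map_finsuppSum]
    simp only [Finsupp.lmapDomain_apply, Finsupp.mapDomain_single]

/-- A one-way head is on cell `t` in every component after `t` steps, so it can be factored out and
the word enters only through the sequence of scanned symbols. States on different inputs become
comparable in one space. -/
theorem evenState_eq {V : Verifier α Q Γ} (hV : V.IsOneWay) (P : Prover α Γ Δ) (x : List α)
    (t : ℕ) : evenState P V x t =
      atCell (t : ZMod (x.length + 2)) (visState V P.blank (P.move x) (symSeq x) t) := by
  induction t with
  | zero =>
    rw [evenState, visState, atCell, Finsupp.lmapDomain_apply, Finsupp.mapDomain_single,
      initConfig, Nat.cast_zero]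
  | succ t ih =>
    rw [evenState, ih, project_verifierOp_atCell hV, proverOp_atCell, visState, Nat.cast_succ]
    rfl

theorem oddState_eq {V : Verifier α Q Γ} (hV : V.IsOneWay) (P : Prover α Γ Δ) (x : List α)
    (t : ℕ) : oddState P V x t = atCell ((t : ZMod (x.length + 2)) + 1)
      (act (V.ampOn (Verifier.onState V.non) (symSeq x t))
        (visState V P.blank (P.move x) (symSeq x) t)) := by
  rw [oddState, evenState_eq hV, project_verifierOp_atCell hV]
  rfl

theorem normSq_project_verifierOp_evenState {V : Verifier α Q Γ} (hV : V.IsOneWay)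
    (P : Prover α Γ Δ) (x : List α) (A : Set Q) (t : ℕ) :
    normSq (project A (verifierOp V P.blank x (evenState P V x t))) =
      normSq (act (V.ampOn (Verifier.onState A) (symSeq x t))
        (visState V P.blank (P.move x) (symSeq x) t)) := by
  rw [evenState_eq hV, project_verifierOp_atCell hV, normSq_atCell]
  rfl

/-! ### Scanned symbols -/

/-- The word `w` is scanned from step `t` on. -/
def Reads (s : ℕ → TapeSymbol α) : ℕ → List α → Prop
  | _, [] => True
  | t, a :: w => s t = TapeSymbol.sym a ∧ Reads s (t + 1) w

theorem reads_append (s : ℕ → TapeSymbol α) (t : ℕ) (u v : List α) :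
    Reads s t (u ++ v) ↔ Reads s t u ∧ Reads s (t + u.length) v := by
  induction u generalizing t with
  | nil => simp [Reads]
  | cons a u ih =>
    rw [List.cons_append, Reads, Reads, ih, and_assoc, List.length_cons]
    rw [show t + 1 + u.length = t + (u.length + 1) by omega]

theorem symSeq_zero (x : List α) : symSeq x 0 = TapeSymbol.cent := by
  simp [symSeq, symbolAt]

theorem symSeq_succ (x : List α) {t : ℕ} (ht : t ≤ x.length) :
    symSeq x (t + 1) = match x[t]? with
      | some a => TapeSymbol.sym a
      | none => TapeSymbol.dollar := by
  have hv : ((t + 1 : ℕ) : ZMod (x.length + 2)).val = t + 1 :=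
    ZMod.val_natCast_of_lt (by omega)
  rw [symSeq, symbolAt, hv, if_neg (by omega)]
  rfl

theorem symSeq_length_succ (x : List α) : symSeq x (x.length + 1) = TapeSymbol.dollar := by
  rw [symSeq_succ x le_rfl]
  simp

theorem reads_symSeq_append (u v : List α) : Reads (symSeq (u ++ v)) (u.length + 1) v := by
  induction v generalizing u with
  | nil => trivial
  | cons a v ih =>
    refine ⟨?_, ?_⟩
    · rw [symSeq_succ _ (by simp)]
      simp
    · have := ih (u ++ [a])
      simpa using this

theorem reads_symSeq (x : List α) : Reads (symSeq x) 1 x := reads_symSeq_append [] x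

theorem symSeq_append_of_le (u v : List α) {t : ℕ} (ht : t ≤ u.length) :
    symSeq (u ++ v) t = symSeq u t := by
  cases t with
  | zero => rw [symSeq_zero, symSeq_zero]
  | succ t =>
    rw [symSeq_succ u (by omega), symSeq_succ (u ++ v) (by simp; omega),
      List.getElem?_append_left (by omega)]

end Positions

/-! ### Computation paths -/

section Paths

variable {α Q Γ Δ : Type} [Fintype Q] [DecidableEq Q] [Fintype Γ] [DecidableEq Γ]
  [Fintype Δ] [DecidableEq Δ]

theorem IsPath.snoc_odd {P : Prover α Γ Δ} {V : Verifier α Q Γ} {x : List α} {t : ℕ}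
    {ξ : ℕ → Config Q Γ Δ P.blank x} (h : IsPath P V x (2 * t) ξ) {c : Config Q Γ Δ P.blank x}
    (ht : t ≤ x.length + 1)
    (hstep : project V.non (verifierOp V P.blank x (Finsupp.single (ξ (2 * t)) 1)) c ≠ 0)
    (hc : oddState P V x t c ≠ 0) :
    IsPath P V x (2 * t + 1) (Function.update ξ (2 * t + 1) c) where
  le_length := by omega
  start := by rw [Function.update_of_ne (by omega)]; exact h.start
  verifier_step i hi := by
    rw [Function.update_of_ne (by omega)]
    by_cases hit : i = t
    · subst hit; rwa [Function.update_self]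
    · rw [Function.update_of_ne (by omega)]; exact h.verifier_step i (by omega)
  prover_step i hi := by
    rw [Function.update_of_ne (by omega), Function.update_of_ne (by omega)]
    exact h.prover_step i (by omega)
  even_amplitude i hi := by
    rw [Function.update_of_ne (by omega)]; exact h.even_amplitude i (by omega)
  odd_amplitude i hi := by
    by_cases hit : i = t
    · subst hit; rwa [Function.update_self]
    · rw [Function.update_of_ne (by omega)]; exact h.odd_amplitude i (by omega)

theorem IsPath.snoc_even {P : Prover α Γ Δ} {V : Verifier α Q Γ} {x : List α} {t : ℕ}
    {ξ : ℕ → Config Q Γ Δ P.blank x} (h : IsPath P V x (2 * t + 1) ξ)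
    {c : Config Q Γ Δ P.blank x} (ht : t ≤ x.length)
    (hstep : proverOp P x t (Finsupp.single (ξ (2 * t + 1)) 1) c ≠ 0)
    (hc : evenState P V x (t + 1) c ≠ 0) :
    IsPath P V x (2 * (t + 1)) (Function.update ξ (2 * (t + 1)) c) where
  le_length := by omega
  start := by rw [Function.update_of_ne (by omega)]; exact h.start
  verifier_step i hi := by
    rw [Function.update_of_ne (by omega), Function.update_of_ne (by omega)]
    exact h.verifier_step i (by omega)
  prover_step i hi := by
    rw [Function.update_of_ne (by omega)]
    by_cases hit : i = t
    · subst hit; rw [show 2 * i + 2 = 2 * (i + 1) by ring, Function.update_self]; exact hstep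
    · rw [Function.update_of_ne (by omega)]; exact h.prover_step i (by omega)
  even_amplitude i hi := by
    by_cases hit : i = t + 1
    · subst hit; rwa [Function.update_self]
    · rw [Function.update_of_ne (by omega)]; exact h.even_amplitude i (by omega)
  odd_amplitude i hi := by
    rw [Function.update_of_ne (by omega)]; exact h.odd_amplitude i (by omega)

theorem exists_of_oddState_ne_zero {P : Prover α Γ Δ} {V : Verifier α Q Γ} {x : List α} {t : ℕ}
    {c : Config Q Γ Δ P.blank x} (hc : oddState P V x t c ≠ 0) :
    c.1 ∈ V.non ∧ ∃ c₀, evenState P V x t c₀ ≠ 0 ∧ c₀.2.2.2 = c.2.2.2 ∧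
      project V.non (verifierOp V P.blank x (Finsupp.single c₀ 1)) c ≠ 0 := by
  classical
  rw [oddState, project_apply] at hc
  have hnon : c.1 ∈ V.non := by
    by_contra h
    exact hc (if_neg h)
  rw [if_pos hnon] at hc
  obtain ⟨c₀, h0, h1⟩ := exists_apply_single_ne_zero hc
  refine ⟨hnon, c₀, h0, ?_, by rwa [project_apply, if_pos hnon]⟩
  by_contra hne
  apply h1
  rw [verifierOp, Finsupp.linearCombination_single, one_smul, Finsupp.finsetSum_apply]
  refine Finset.sum_eq_zero fun v _ => ?_
  rw [Finsupp.single_apply, if_neg]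
  rintro rfl
  exact hne rfl

/-- A configuration is a query made by the verifier. -/
def IsQuery (V : Verifier α Q Γ) {b : Δ} {x : List α} (c : Config Q Γ Δ b x) : Prop :=
  c.1 ∈ V.non ∧ c.2.2.1 ≠ V.blank

/-- The path is built by choosing a predecessor of non-zero amplitude at each move. A committed
prover can alter a blank tape only in reply to a non-blank symbol, so a written tape certifies an
earlier query. -/
theorem exists_isPath {P : Prover α Γ Δ} {V : Verifier α Q Γ} (hP : P.Committed V.blank)
    {x : List α} {t : ℕ} (ht : t ≤ x.length + 1) {c : Config Q Γ Δ P.blank x}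
    (hc : evenState P V x t c ≠ 0) :
    ∃ ξ, IsPath P V x (2 * t) ξ ∧ ξ (2 * t) = c ∧
      (c.2.2.2 ≠ PrivateTape.allBlank → ∃ j < t, IsQuery V (ξ (2 * j + 1))) := by
  classical
  induction t generalizing c with
  | zero =>
    have hc' : c = initConfig P V x := by
      by_contra hne
      exact hc (by rw [evenState, Finsupp.single_apply, if_neg (Ne.symm hne)])
    refine ⟨fun _ => c, ⟨by omega, hc', ?_, ?_, ?_, ?_⟩, rfl, ?_⟩
    · intro i hi; omega
    · intro i hi; omega
    · intro i hi
      obtain rfl : i = 0 := by omega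
      exact hc
    · intro i hi; omega
    · intro h; exact absurd (by rw [hc']; rfl) h
  | succ t ih =>
    obtain ⟨c₁, h1, h2⟩ := exists_apply_single_ne_zero
      (show proverOp P x t (oddState P V x t) c ≠ 0 from hc)
    obtain ⟨hnon, c₀, h3, h4, h5⟩ := exists_of_oddState_ne_zero h1
    obtain ⟨ξ, hξ, hlast, hq⟩ := ih (by omega) h3
    rw [← hlast] at h5
    have hp1 := hξ.snoc_odd (by omega) h5 h1
    have hp2 := hp1.snoc_even (c := c) (by omega) (by rwa [Function.update_self]) hc
    refine ⟨_, hp2, Function.update_self .., fun htape => ?_⟩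
    by_cases hb : c₀.2.2.2 = PrivateTape.allBlank
    · refine ⟨t, by omega, ?_⟩
      rw [Function.update_of_ne (by omega), Function.update_self]
      refine ⟨hnon, fun hblank => htape ?_⟩
      have hfix : proverOp P x t (Finsupp.single c₁ 1) = Finsupp.single c₁ 1 := by
        rw [proverOp, Finsupp.linearCombination_single, one_smul, hblank, ← h4, hb,
          hP x t _ (by
            rw [reach_eq_reachSet]
            exact allBlank_mem_reachSet ((committed_iff P V.blank).1 hP x) t),
          Finsupp.sum_single_index (by simp), ← hblank, ← hb, h4]
      rw [hfix, Finsupp.single_apply] at h2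
      have : c₁ = c := by
        by_contra hne
        exact h2 (if_neg hne)
      rw [← this, ← h4, hb]
    · obtain ⟨j, hj, hj'⟩ := hq hb
      refine ⟨j, by omega, ?_⟩
      rwa [Function.update_of_ne (by omega), Function.update_of_ne (by omega)]

/-- If at most one interaction is made, no query is made while the private tape is not blank. -/
theorem allBlank_of_interactionsLE_one {P : Prover α Γ Δ} {V : Verifier α Q Γ}
    (hP : P.Committed V.blank) {x : List α} (hI : InteractionsLE P V 1 x) {t : ℕ}
    (ht : t ≤ x.length + 1) {c : Config Q Γ Δ P.blank x} (hc : oddState P V x t c ≠ 0)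
    (hquery : c.2.2.1 ≠ V.blank) : c.2.2.2 = PrivateTape.allBlank := by
  classical
  by_contra htape
  obtain ⟨hnon, c₀, h3, h4, h5⟩ := exists_of_oddState_ne_zero hc
  obtain ⟨ξ, hξ, hlast, hq⟩ := exists_isPath hP ht h3
  obtain ⟨j, hj, hj'⟩ := hq (by rwa [h4])
  rw [← hlast] at h5
  have hle := hI _ _ (hξ.snoc_odd ht h5 hc)
  rw [queryCount, ← not_lt] at hle
  apply hle
  rw [Finset.one_lt_card]
  refine ⟨2 * j + 1, ?_, 2 * t + 1, ?_, by omega⟩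
  · rw [Finset.mem_filter, Function.update_of_ne (by omega)]
    exact ⟨Finset.mem_range.2 (by omega), ⟨j, rfl⟩, hj'⟩
  · rw [Finset.mem_filter, Function.update_self]
    exact ⟨Finset.mem_range.2 (by omega), ⟨t, rfl⟩, hnon, hquery⟩

end Paths

/-! ### Permutation moves -/

section PermMove

variable {Q Γ Δ : Type} [Fintype Γ] [DecidableEq Γ] [Fintype Δ] [DecidableEq Δ] {b : Δ}

/-- The prover move that permutes the basis vectors. -/
def permMove (e : Equiv.Perm (Γ × (Fin 1 → Δ))) : ProverMove Γ Δ where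
  cells := 1
  S := ⟨Matrix.of fun p c => if p = e c then 1 else 0, by
    rw [Matrix.mem_unitaryGroup_iff']
    ext c c'
    simpa [Matrix.mul_apply, Matrix.star_apply, Matrix.one_apply] using if_congr eq_comm rfl rfl⟩

theorem onBasis_permMove (e : Equiv.Perm (Γ × (Fin 1 → Δ))) (γ : Γ) (y : PrivateTape Δ b) :
    (permMove e).onBasis γ y = Finsupp.single
      ((e (γ, y.front 1)).1, y.overwrite (e (γ, y.front 1)).2) 1 := by
  rw [ProverMove.onBasis]
  refine (Finset.sum_eq_single (e (γ, y.front 1)) ?_ fun h => absurd (Finset.mem_univ _) h).trans ?_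
  · intro p _ hp
    have : (permMove e).S.1 p (γ, y.front 1) = 0 := if_neg hp
    exact (congrArg _ this).trans (Finsupp.single_zero _)
  · have : (permMove e).S.1 (e (γ, y.front 1)) (γ, y.front 1) = 1 := if_pos rfl
    exact congrArg _ this

theorem onBasis_permMove_of_fixed {e : Equiv.Perm (Γ × (Fin 1 → Δ))} {γ : Γ}
    {y : PrivateTape Δ b} (h : e (γ, y.front 1) = (γ, y.front 1)) :
    (permMove e).onBasis γ y = Finsupp.single (γ, y) 1 := by
  rw [onBasis_permMove, h]
  congr 2
  apply Subtype.ext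
  funext i
  simp [PrivateTape.overwrite, PrivateTape.front]

theorem proverAct_permMove_one (Φ : (Q × Γ) × PrivateTape Δ b →₀ ℂ) :
    proverAct (permMove 1) Φ = Φ :=
  proverAct_eq_self fun _ _ _ _ => onBasis_permMove_of_fixed rfl

end PermMove

/-! ### Vectors that cause no further queries -/

section NoQuery

variable {α Q Γ Δ : Type} [Fintype Q] [DecidableEq Q] [Fintype Γ] [DecidableEq Γ]
  [Fintype Δ] [DecidableEq Δ]

/-- The non-halting part of the transition matrix of an input letter. -/
noncomputable def Verifier.nonMat (V : Verifier α Q Γ) (a : α) : Matrix (Q × Γ) (Q × Γ) ℂ :=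
  V.ampOn (Verifier.onState V.non) (TapeSymbol.sym a)

/-- The part of the transition matrix of an input letter without halting and queries. -/
noncomputable def Verifier.idleMat (V : Verifier α Q Γ) (a : α) : Matrix (Q × Γ) (Q × Γ) ℂ :=
  V.ampOn V.idle (TapeSymbol.sym a)

/-- The part of the transition matrix of an input letter that makes a query. -/
noncomputable def Verifier.queryMat (V : Verifier α Q Γ) (a : α) : Matrix (Q × Γ) (Q × Γ) ℂ :=
  V.ampOn V.query (TapeSymbol.sym a)

/-- The vectors from which no word leads to a query. -/
noncomputable def noQuery (V : Verifier α Q Γ) : Submodule ℂ (Q × Γ → ℂ) where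
  carrier := {f | ∀ u a, (V.queryMat a).mulVec ((wordMat V.nonMat u).mulVec f) = 0}
  add_mem' hf hg u a := by simp [Matrix.mulVec_add, hf u a, hg u a]
  zero_mem' := by simp
  smul_mem' c f hf u a := by simp [Matrix.mulVec_smul, hf u a]

/-- The non-halting vector after the left endmarker and `w`, when the prover does nothing. -/
noncomputable def freeVec (V : Verifier α Q Γ) (w : List α) : Q × Γ → ℂ :=
  (wordMat V.nonMat w).mulVec ((V.ampOn (Verifier.onState V.non) TapeSymbol.cent).mulVec
    (Pi.single (V.init, V.blank) 1))

theorem visState_add_length (V : Verifier α Q Γ) (b : Δ) {mv : ℕ → ProverMove Γ Δ}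
    {s : ℕ → TapeSymbol α} {t : ℕ} {u : List α} (hu : Reads s t u)
    (hmv : ∀ i, t ≤ i → i < t + u.length → mv i = permMove 1) :
    visState V b mv s (t + u.length) = act (wordMat V.nonMat u) (visState V b mv s t) := by
  induction u generalizing t with
  | nil => simp [wordMat, act_one]
  | cons a u ih =>
    obtain ⟨h1, h2⟩ := hu
    have h3 : visState V b mv s (t + 1) = act (V.nonMat a) (visState V b mv s t) := by
      rw [visState, hmv t le_rfl (by simp), proverAct_permMove_one, h1]
      rfl
    rw [List.length_cons, show t + (u.length + 1) = t + 1 + u.length by omega,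
      ih h2 (fun i hi hi' => hmv i (by omega) (by rw [List.length_cons]; omega)), h3, wordMat,
      act_mul]

theorem visState_zero (V : Verifier α Q Γ) (b : Δ) (mv : ℕ → ProverMove Γ Δ)
    (s : ℕ → TapeSymbol α) : visState V b mv s 0 =
      atTape PrivateTape.allBlank (Pi.single (V.init, V.blank) 1) := by
  classical
  ext ⟨v, y⟩
  rw [atTape_apply, visState, Finsupp.single_apply, Pi.single_apply]
  by_cases h1 : y = PrivateTape.allBlank <;> by_cases h2 : v = (V.init, V.blank) <;>
    simp [h1, h2, eq_comm]

theorem act_visState_eq_freeVec (V : Verifier α Q Γ) (b : Δ) {mv : ℕ → ProverMove Γ Δ}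
    {s : ℕ → TapeSymbol α} {w : List α} (h0 : s 0 = TapeSymbol.cent) (hw : Reads s 1 w)
    (hmv : ∀ i < w.length, mv i = permMove 1) :
    act (V.ampOn (Verifier.onState V.non) (s w.length)) (visState V b mv s w.length) =
      atTape PrivateTape.allBlank (freeVec V w) := by
  rcases List.eq_nil_or_concat w with rfl | ⟨w, a, rfl⟩
  · rw [List.length_nil, visState_zero, act_atTape, h0, freeVec, wordMat, Matrix.one_mulVec]
  · rw [List.concat_eq_append] at *
    obtain ⟨h1, h2⟩ := (reads_append s 1 w [a]).1 hw
    have h3 : visState V b mv s 1 = atTape PrivateTape.allBlank (freeVec V []) := by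
      rw [visState, hmv 0 (by simp), proverAct_permMove_one, visState_zero, act_atTape, h0,
        freeVec, wordMat, Matrix.one_mulVec]
    rw [List.length_append, List.length_singleton, add_comm w.length 1, h2.1,
      visState_add_length V b h1 (fun i _ hi => hmv i (by simp; omega)), h3, act_atTape,
      act_atTape, freeVec, freeVec, wordMat_append, wordMat_singleton, wordMat,
      Matrix.one_mulVec, ← Matrix.mulVec_mulVec]
    rfl

/-- If on some continuation of every word all committed provers are asked at most once, then
the vector that remains after a query and an answer leads to no further query. -/
theorem tensorSym_mem_noQuery {V : Verifier α Q Γ} (hV : V.IsOneWay) (c : α)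
    (hI : ∀ (x : List α) (P : Prover α Γ Bool), P.Committed V.blank →
      InteractionsLE P V 1 (x ++ [c]))
    (w : List α) {γ : Γ} (hγ : γ ≠ V.blank) (γ' : Γ) :
    tensorSym (fun q => freeVec V w (q, γ)) γ' ∈ noQuery V := by
  classical
  intro u a
  let off : Fin 1 → Bool := fun _ => false
  let on : Fin 1 → Bool := fun _ => true
  have hoff : off ≠ on := fun h => by simpa [off, on] using congrFun h 0
  -- The test prover answers `γ` by `γ'` and marks its first cell. Moves are numbered from 0 and the
  -- left endmarker takes one step, so move `w.length` comes right after the last letter of `w` is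
  -- scanned. All other moves are the identity.
  let e : Equiv.Perm (Γ × (Fin 1 → Bool)) := Equiv.swap (γ, off) (γ', on)
  let mv : ℕ → ProverMove Γ Bool := fun t => permMove (if t = w.length then e else 1)
  have hmv : ∀ t, t ≠ w.length → mv t = permMove 1 := fun t ht => by simp [mv, ht]
  have hmvw : mv w.length = permMove e := by simp [mv]
  let blankTape : PrivateTape Bool false := PrivateTape.allBlank
  have hfront : blankTape.front 1 = off := rfl
  have hfix : ∀ γ₀ ≠ γ, (permMove e).onBasis γ₀ blankTape = Finsupp.single (γ₀, blankTape) 1 := by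
    intro γ₀ h
    apply onBasis_permMove_of_fixed
    rw [hfront]
    exact Equiv.swap_apply_of_ne_of_ne (by simp [h]) (by simp [hoff])
  let marked : PrivateTape Bool false := blankTape.overwrite on
  have hmarked : marked ≠ blankTape := by
    intro h
    have := congrFun (congrArg Subtype.val h) 0
    simp [marked, PrivateTape.overwrite, on, blankTape, PrivateTape.allBlank] at this
  have hreach : ∀ t ≤ w.length, ∀ y ∈ reachSet false mv t, y = blankTape := by
    intro t ht
    induction t with
    | zero => intro y hy; exact hy
    | succ t ih =>
      rintro y ⟨z, hz, σ, τ, hne⟩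
      rw [hmv t (by omega), onBasis_permMove_of_fixed rfl, Finsupp.single_apply] at hne
      rw [← ih (by omega) z hz]
      by_contra hyz
      exact hne (if_neg (by simp [Ne.symm hyz]))
  let P : Prover α Γ Bool := ⟨false, fun _ => mv⟩
  -- At the only non-trivial turn the reachable tape is still blank, and there the swap fixes every
  -- symbol except `γ`, which is not the blank.
  have hP : P.Committed V.blank := by
    rw [committed_iff]
    intro x t y hy
    by_cases ht : t = w.length
    · subst ht
      rw [hreach _ le_rfl y hy]
      change (mv w.length).onBasis V.blank blankTape = _
      rw [hmvw]
      exact hfix _ hγ.symm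
    · change (mv t).onBasis V.blank y = _
      rw [hmv t ht]
      exact onBasis_permMove_of_fixed rfl
  -- The extra letter `c` brings the input among those with an interaction bound, for arbitrary `u`
  -- and `a`.
  let s := symSeq (w ++ u ++ [a] ++ [c])
  have hs := (reads_append _ _ _ _).1 (reads_symSeq (w ++ u ++ [a] ++ [c]))
  obtain ⟨h1, h2⟩ := (reads_append _ _ _ _).1 hs.1
  obtain ⟨h3, h4⟩ := (reads_append _ _ _ _).1 h1
  -- The mark separates the answered query from everything else, so no interference can cancel it.
  have hst : slice (visState V false mv s (w.length + 1)) marked =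
      tensorSym (fun q => freeVec V w (q, γ)) γ' := by
    rw [visState, act_visState_eq_freeVec V false (symSeq_zero _) h3 (fun i hi => hmv i hi.ne),
      slice_proverAct_atTape, Finset.sum_eq_single γ, Finset.sum_eq_single γ']
    · rw [hmvw, onBasis_permMove]
      change (Finsupp.single ((e (γ, off)).1, blankTape.overwrite (e (γ, off)).2) (1 : ℂ))
        (γ', marked) • _ = _
      rw [Equiv.swap_apply_left]
      simp [marked]
    · intro γ₁ _ hγ₁
      rw [hmvw, onBasis_permMove]
      change (Finsupp.single ((e (γ, off)).1, blankTape.overwrite (e (γ, off)).2) (1 : ℂ))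
        (γ₁, marked) • _ = _
      rw [Equiv.swap_apply_left, Finsupp.single_apply, if_neg (by simp [Ne.symm hγ₁]), zero_smul]
    · simp
    · intro γ₀ _ hγ₀
      refine Finset.sum_eq_zero fun γ₁ _ => ?_
      rw [hmvw]
      have := hfix γ₀ hγ₀
      change ((permMove e).onBasis γ₀ blankTape) (γ₁, marked) • _ = _
      rw [this, Finsupp.single_apply, if_neg (by simp [hmarked.symm]), zero_smul]
    · simp
  have hlen : 1 + w.length = w.length + 1 := add_comm _ _
  rw [hlen] at h4
  have hslice : slice (act (V.ampOn (Verifier.onState V.non) (s (w.length + 1 + u.length)))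
      (visState V false mv s (w.length + 1 + u.length))) marked =
      (V.nonMat a).mulVec ((wordMat V.nonMat u).mulVec
        (tensorSym (fun q => freeVec V w (q, γ)) γ')) := by
    have hsa : s (w.length + 1 + u.length) = TapeSymbol.sym a := by
      have := h2.1
      rwa [List.length_append, ← add_assoc, hlen] at this
    rw [slice_act, visState_add_length V false h4 (fun i hi _ => hmv i (by omega)), slice_act,
      hst, hsa]
    rfl
  funext ⟨q, γ₁⟩
  by_contra hne
  rw [Verifier.queryMat, Verifier.ampOn_mulVec] at hne
  have hq : (q, γ₁) ∈ V.query := by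
    by_contra h
    exact hne (if_neg h)
  rw [if_pos hq] at hne
  -- A non-zero query amplitude on the marked tape would be a second query on some path.
  refine hmarked (allBlank_of_interactionsLE_one hP (hI (w ++ u ++ [a]) P hP)
    (t := w.length + 1 + u.length) (by simp; omega)
    (c := (q, ((w.length + 1 + u.length : ℕ) : ZMod _) + 1, γ₁, marked)) ?_ hq.2)
  rw [oddState_eq hV, atCell_apply, if_pos rfl]
  change slice (act (V.ampOn (Verifier.onState V.non) (s (w.length + 1 + u.length)))
      (visState V false mv s (w.length + 1 + u.length))) marked (q, γ₁) ≠ 0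
  rw [hslice, Verifier.nonMat, Verifier.ampOn_mulVec, if_pos (show _ ∈ Verifier.onState _ from hq.1)]
  exact hne

end NoQuery

/-! ### Decomposition into idle evolution, answered queries and new queries -/

section Decomposition

variable {α Q Γ Δ : Type} [Fintype Q] [DecidableEq Q] [Fintype Γ] [DecidableEq Γ]
  [Fintype Δ] [DecidableEq Δ]

theorem nonMat_mulVec_mem_noQuery {V : Verifier α Q Γ} {f : Q × Γ → ℂ} (hf : f ∈ noQuery V)
    (a : α) : (V.nonMat a).mulVec f ∈ noQuery V := by
  intro u c
  have := hf (a :: u) c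
  rwa [wordMat, ← Matrix.mulVec_mulVec] at this

theorem queryMat_mulVec_of_mem_noQuery {V : Verifier α Q Γ} {f : Q × Γ → ℂ}
    (hf : f ∈ noQuery V) (a : α) : (V.queryMat a).mulVec f = 0 := by
  have := hf [] a
  rwa [wordMat, Matrix.one_mulVec] at this

theorem ampOn_query_apply (V : Verifier α Q Γ) (σ : TapeSymbol α) (f : Q × Γ → ℂ) (q : Q)
    (γ : Γ) : (V.ampOn V.query σ).mulVec f (q, γ) = if γ = V.blank then 0 else
      (V.ampOn (Verifier.onState V.non) σ).mulVec f (q, γ) := by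
  classical
  rw [Verifier.ampOn_mulVec, Verifier.ampOn_mulVec]
  by_cases h : γ = V.blank <;> by_cases h2 : q ∈ V.non <;>
    simp [Verifier.query, Verifier.onState, h, h2]

/-- Every answer to a query made at the next step leads to no further query. -/
def SafeQueries (V : Verifier α Q Γ) (σ : TapeSymbol α) (f : Q × Γ → ℂ) : Prop :=
  ∀ γ ≠ V.blank, ∀ γ',
    tensorSym (fun q => (V.ampOn (Verifier.onState V.non) σ).mulVec f (q, γ)) γ' ∈ noQuery V

theorem tensorSym_query_mem {V : Verifier α Q Γ} {σ : TapeSymbol α} {f : Q × Γ → ℂ}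
    (h : SafeQueries V σ f) (γ γ' : Γ) :
    tensorSym (fun q => (V.ampOn V.query σ).mulVec f (q, γ)) γ' ∈ noQuery V := by
  simp only [ampOn_query_apply]
  by_cases hγ : γ = V.blank
  · simp only [hγ, if_pos]
    have h0 : tensorSym (fun _ : Q => (0 : ℂ)) γ' = 0 := by
      funext v; simp [tensorSym]
    rw [h0]
    exact Submodule.zero_mem _
  · simp only [hγ, if_false]
    exact h γ hγ γ'

theorem ampOn_query_mem {V : Verifier α Q Γ} {σ : TapeSymbol α} {f : Q × Γ → ℂ}
    (h : SafeQueries V σ f) : (V.ampOn V.query σ).mulVec f ∈ noQuery V := by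
  have heq : (V.ampOn V.query σ).mulVec f =
      ∑ γ, tensorSym (fun q => (V.ampOn V.query σ).mulVec f (q, γ)) γ := by
    funext ⟨q, γ⟩
    simp [Finset.sum_apply, tensorSym]
  rw [heq]
  exact Submodule.sum_mem _ fun γ _ => tensorSym_query_mem h γ γ

/-- The vector after the left endmarker and `w` without halting and queries. -/
noncomputable def idleVec (V : Verifier α Q Γ) (w : List α) : Q × Γ → ℂ :=
  (wordMat V.idleMat w).mulVec ((V.ampOn V.idle TapeSymbol.cent).mulVec
    (Pi.single (V.init, V.blank) 1))

theorem freeVec_snoc (V : Verifier α Q Γ) (w : List α) (a : α) :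
    freeVec V (w ++ [a]) = (V.nonMat a).mulVec (freeVec V w) := by
  rw [freeVec, freeVec, wordMat_append, wordMat_singleton, ← Matrix.mulVec_mulVec]

theorem idleVec_append (V : Verifier α Q Γ) (w v : List α) :
    idleVec V (w ++ v) = (wordMat V.idleMat v).mulVec (idleVec V w) := by
  rw [idleVec, idleVec, wordMat_append, ← Matrix.mulVec_mulVec]

theorem nonMat_eq (V : Verifier α Q Γ) (a : α) : V.nonMat a = V.idleMat a + V.queryMat a :=
  V.ampOn_non _

/-- Whenever a query is made in the undisturbed evolution, every answer to it leads to no further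
query. -/
def OneQuery (V : Verifier α Q Γ) : Prop :=
  ∀ w, ∀ γ ≠ V.blank, ∀ γ', tensorSym (fun q => freeVec V w (q, γ)) γ' ∈ noQuery V

theorem OneQuery.safeQueries_cent {V : Verifier α Q Γ} (h : OneQuery V) :
    SafeQueries V TapeSymbol.cent (Pi.single (V.init, V.blank) 1) := by
  intro γ hγ γ'
  have := h [] γ hγ γ'
  rwa [freeVec, wordMat, Matrix.one_mulVec] at this

theorem OneQuery.safeQueries_freeVec {V : Verifier α Q Γ} (h : OneQuery V) (w : List α) (a : α) :
    SafeQueries V (TapeSymbol.sym a) (freeVec V w) := by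
  intro γ hγ γ'
  have := h (w ++ [a]) γ hγ γ'
  rwa [freeVec_snoc] at this

/-- The difference consists of the evolved queries that an inactive prover has handed back
unchanged. This is the answer `γ' = γ`, so `OneQuery` covers them. -/
theorem OneQuery.freeVec_sub_idleVec_mem {V : Verifier α Q Γ} (h : OneQuery V) (w : List α) :
    freeVec V w - idleVec V w ∈ noQuery V := by
  induction w using List.reverseRecOn with
  | nil =>
    rw [freeVec, idleVec, wordMat, wordMat, Matrix.one_mulVec, Matrix.one_mulVec,
      Verifier.ampOn_non, Matrix.add_mulVec, add_sub_cancel_left]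
    exact ampOn_query_mem h.safeQueries_cent
  | append_singleton w a ih =>
    have h1 := ampOn_query_mem (h.safeQueries_freeVec w a)
    have h2 := queryMat_mulVec_of_mem_noQuery ih a
    rw [Matrix.mulVec_sub, sub_eq_zero] at h2
    have h3 : freeVec V (w ++ [a]) - idleVec V (w ++ [a]) =
        (V.nonMat a).mulVec (freeVec V w - idleVec V w) + (V.queryMat a).mulVec (freeVec V w) := by
      rw [freeVec_snoc, idleVec_append, wordMat_singleton, Matrix.mulVec_sub, h2]
      simp only [nonMat_eq, Matrix.add_mulVec]
      abel
    rw [h3]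
    exact Submodule.add_mem _ (nonMat_mulVec_mem_noQuery ih a) h1

/-- `freeVec` and `idleVec` differ by an element of `noQuery`, hence make the same queries at the
next letter. This transfers what the test provers reveal about the free evolution to the idle one.
-/
theorem OneQuery.safeQueries_idleVec {V : Verifier α Q Γ} (h : OneQuery V) (w : List α) (a : α) :
    SafeQueries V (TapeSymbol.sym a) (idleVec V w) := by
  intro γ hγ γ'
  have h2 := queryMat_mulVec_of_mem_noQuery (h.freeVec_sub_idleVec_mem w) a
  rw [Matrix.mulVec_sub, sub_eq_zero] at h2
  convert h.safeQueries_freeVec w a γ hγ γ' using 3 with q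
  have h3 := congrFun h2 (q, γ)
  rw [Verifier.queryMat, ampOn_query_apply, ampOn_query_apply, if_neg hγ, if_neg hγ] at h3
  exact h3.symm

/-! ### Quiet superpositions and the three-part decomposition -/

/-- The slices of a superposition lead to no query, and its private tapes are reachable. -/
structure Quiet (V : Verifier α Q Γ) {b : Δ} (mv : ℕ → ProverMove Γ Δ) (t : ℕ)
    (Φ : (Q × Γ) × PrivateTape Δ b →₀ ℂ) : Prop where
  mem : ∀ y, slice Φ y ∈ noQuery V
  reach : ∀ y, slice Φ y ≠ 0 → y ∈ reachSet b mv t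

/-- The next step of the verifier makes `Φ` quiet and makes no query. -/
structure QuietNext (V : Verifier α Q Γ) {b : Δ} (mv : ℕ → ProverMove Γ Δ) (t : ℕ)
    (σ : TapeSymbol α) (Φ : (Q × Γ) × PrivateTape Δ b →₀ ℂ) : Prop where
  mem : ∀ y, (V.ampOn V.idle σ).mulVec (slice Φ y) ∈ noQuery V
  query : ∀ y, (V.ampOn V.query σ).mulVec (slice Φ y) = 0
  reach : ∀ y, slice Φ y ≠ 0 → y ∈ reachSet b mv t

/-- Needed at the left endmarker: `noQuery` concerns input letters only, and in the first step both
answered parts are zero. -/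
theorem quietNext_zero (V : Verifier α Q Γ) {b : Δ} (mv : ℕ → ProverMove Γ Δ) (t : ℕ)
    (σ : TapeSymbol α) :
    QuietNext V mv t σ (0 : (Q × Γ) × PrivateTape Δ b →₀ ℂ) := by
  have h0 : ∀ y, slice (0 : (Q × Γ) × PrivateTape Δ b →₀ ℂ) y = 0 := fun y => rfl
  exact ⟨fun y => by simp [h0], fun y => by simp [h0], fun y h => absurd (h0 y) h⟩

theorem quiet_zero (V : Verifier α Q Γ) {b : Δ} (mv : ℕ → ProverMove Γ Δ) (t : ℕ) :
    Quiet V mv t (0 : (Q × Γ) × PrivateTape Δ b →₀ ℂ) :=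
  ⟨fun _ => Submodule.zero_mem _, fun _ h => absurd rfl h⟩

theorem Quiet.quietNext {V : Verifier α Q Γ} {b : Δ} {mv : ℕ → ProverMove Γ Δ} {t : ℕ}
    {Φ : (Q × Γ) × PrivateTape Δ b →₀ ℂ} (h : Quiet V mv t Φ) (a : α) :
    QuietNext V mv t (TapeSymbol.sym a) Φ where
  mem y := by
    have h1 := nonMat_mulVec_mem_noQuery (h.mem y) a
    rwa [nonMat_eq, Matrix.add_mulVec, queryMat_mulVec_of_mem_noQuery (h.mem y) a, add_zero] at h1
  query y := queryMat_mulVec_of_mem_noQuery (h.mem y) a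
  reach := h.reach

theorem Quiet.add {V : Verifier α Q Γ} {b : Δ} {mv : ℕ → ProverMove Γ Δ} {t : ℕ}
    {Φ Ψ : (Q × Γ) × PrivateTape Δ b →₀ ℂ} (h : Quiet V mv t Φ) (h' : Quiet V mv t Ψ) :
    Quiet V mv t (Φ + Ψ) where
  mem y := Submodule.add_mem _ (h.mem y) (h'.mem y)
  reach y hy := by
    by_cases h1 : slice Φ y = 0
    · refine h'.reach y fun h2 => hy ?_
      rw [slice_add, h1, h2, add_zero]
    · exact h.reach y h1

theorem act_idle_apply_of_ne (V : Verifier α Q Γ) (σ : TapeSymbol α) {T : Type}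
    (Φ : (Q × Γ) × T →₀ ℂ) (q : Q) {γ : Γ} (hγ : γ ≠ V.blank) (y : T) :
    act (V.ampOn V.idle σ) Φ ((q, γ), y) = 0 := by
  classical
  rw [act_apply, Verifier.ampOn_mulVec, if_neg fun h => hγ h.2]

theorem proverAct_act_idle {V : Verifier α Q Γ} {b : Δ} {mv : ℕ → ProverMove Γ Δ}
    (hmv : CommittedMoves b V.blank mv) {t : ℕ} (σ : TapeSymbol α)
    {Φ : (Q × Γ) × PrivateTape Δ b →₀ ℂ} (h : ∀ y, slice Φ y ≠ 0 → y ∈ reachSet b mv t) :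
    proverAct (mv t) (act (V.ampOn V.idle σ) Φ) = act (V.ampOn V.idle σ) Φ := by
  refine proverAct_eq_self fun q γ y hne => ?_
  have hγ : γ = V.blank := by
    by_contra hγ
    exact hne (act_idle_apply_of_ne V σ Φ q hγ y)
  subst hγ
  refine hmv t y (h y fun h0 => hne ?_)
  rw [act_apply, h0, Matrix.mulVec_zero]
  rfl

theorem QuietNext.act_non {V : Verifier α Q Γ} {b : Δ} {mv : ℕ → ProverMove Γ Δ} {t : ℕ}
    {σ : TapeSymbol α} {Φ : (Q × Γ) × PrivateTape Δ b →₀ ℂ} (h : QuietNext V mv t σ Φ) :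
    act (V.ampOn (Verifier.onState V.non) σ) Φ = act (V.ampOn V.idle σ) Φ := by
  have h0 : act (V.ampOn V.query σ) Φ = 0 :=
    ext_slice fun y => by rw [slice_act, h.query y]; rfl
  rw [Verifier.ampOn_non, act_add, h0, add_zero]

theorem QuietNext.quiet_act {V : Verifier α Q Γ} {b : Δ} {mv : ℕ → ProverMove Γ Δ} {t : ℕ}
    {σ : TapeSymbol α} {Φ : (Q × Γ) × PrivateTape Δ b →₀ ℂ} (h : QuietNext V mv t σ Φ)
    (hmv : CommittedMoves b V.blank mv) :
    Quiet V mv (t + 1) (act (V.ampOn V.idle σ) Φ) where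
  mem y := by rw [slice_act]; exact h.mem y
  reach y hy := mem_reachSet_succ hmv <| h.reach y fun h0 => hy <| by
    rw [slice_act, h0, Matrix.mulVec_zero]

/-- One step of the decomposition. -/
theorem visState_succ_decomposition {V : Verifier α Q Γ} (hW : V.WellFormed) (hV : V.IsOneWay)
    {b : Δ} {mv : ℕ → ProverMove Γ Δ} (hmv : CommittedMoves b V.blank mv)
    {s : ℕ → TapeSymbol α} {t : ℕ} {ψ : Q × Γ → ℂ} {O N : (Q × Γ) × PrivateTape Δ b →₀ ℂ}
    (hst : visState V b mv s t = atTape PrivateTape.allBlank ψ + O + N)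
    (hψ : SafeQueries V (s t) ψ) (hO : QuietNext V mv t (s t) O)
    (hN : QuietNext V mv t (s t) N) :
    ∃ N' : (Q × Γ) × PrivateTape Δ b →₀ ℂ,
      visState V b mv s (t + 1) =
        atTape PrivateTape.allBlank ((V.ampOn V.idle (s t)).mulVec ψ) +
          act (V.ampOn V.idle (s t)) O + N' ∧
      Quiet V mv (t + 1) N' ∧
      normSq N' + vecNormSq ((V.ampOn V.idle (s t)).mulVec ψ) ≤ normSq N + vecNormSq ψ := by
  classical
  set R := V.ampOn V.idle (s t)
  set q := (V.ampOn V.query (s t)).mulVec ψ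
  have hblank := allBlank_mem_reachSet hmv t
  have hreach : ∀ f : Q × Γ → ℂ, ∀ y, slice (atTape PrivateTape.allBlank f) y ≠ 0 →
      y ∈ reachSet b mv t := by
    intro f y hy
    by_cases h : y = PrivateTape.allBlank
    · rw [h]; exact hblank
    · exact absurd (slice_atTape_of_ne h f) hy
  have hfixN : proverAct (mv t) (act R N) = act R N := proverAct_act_idle hmv (s t) hN.reach
  -- The prover fixes all idle components, so its move has an effect only on the new queries `q`.
  refine ⟨proverAct (mv t) (act R N + atTape PrivateTape.allBlank q), ?_, ?_, ?_⟩
  · rw [visState, hst, map_add, map_add (act _) (atTape _ _), hO.act_non, hN.act_non, act_atTape, Verifier.ampOn_non,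
      Matrix.add_mulVec, atTape_add, ← act_atTape]
    simp only [map_add]
    rw [proverAct_act_idle hmv (s t) (hreach ψ), proverAct_act_idle hmv (s t) hO.reach, hfixN,
      act_atTape]
    abel
  · rw [map_add, hfixN]
    refine (hN.quiet_act hmv).add ⟨fun y => ?_, fun y hy => mem_reachSet_proverAct (hreach q) hy⟩
    -- On each tape the reply is a linear combination of the elementary answers, and `noQuery` is a
    -- subspace.
    rw [slice_proverAct_atTape]
    exact Submodule.sum_mem _ fun γ _ => Submodule.sum_mem _ fun γ' _ =>
      Submodule.smul_mem _ _ (tensorSym_query_mem hψ γ γ')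
  -- The evolved `N` has a blank communication symbol and `q` a non-blank one, so Pythagoras
  -- applies. The norm of `q` is paid for by what `ψ` loses.
  · rw [normSq_proverAct, normSq_add_of_disjoint, normSq_atTape]
    · have h1 := Verifier.normSq_act_ampOn_le hW hV V.idle (s t) N
      have h2 := Verifier.vecNormSq_ampOn_add_le hW hV V.disjoint_idle_query (s t) ψ
      linarith
    · rintro ⟨⟨q', γ⟩, y⟩
      by_cases hγ : γ = V.blank
      · right
        have hq : q (q', γ) = 0 := (ampOn_query_apply V (s t) ψ q' γ).trans (if_pos hγ)
        rw [atTape_apply, hq, ite_self]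
      · left
        exact act_idle_apply_of_ne V (s t) N q' hγ y

/-- The one-step bounds telescope. `O` is kept apart from `N` because it evolves by a matrix that
does not depend on the prover, while `N` is controlled only in norm, by a loss that does not depend
on the prover either. -/
theorem visState_add_length_decomposition {V : Verifier α Q Γ} (hW : V.WellFormed)
    (hV : V.IsOneWay) {b : Δ} {mv : ℕ → ProverMove Γ Δ} (hmv : CommittedMoves b V.blank mv)
    {s : ℕ → TapeSymbol α} {t : ℕ} {ψ : Q × Γ → ℂ} {O N : (Q × Γ) × PrivateTape Δ b →₀ ℂ}
    {v : List α} (hv : Reads s t v)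
    (hst : visState V b mv s t = atTape PrivateTape.allBlank ψ + O + N)
    (hψ : ∀ u a, SafeQueries V (TapeSymbol.sym a) ((wordMat V.idleMat u).mulVec ψ))
    (hO : Quiet V mv t O) (hN : Quiet V mv t N) :
    ∃ N' : (Q × Γ) × PrivateTape Δ b →₀ ℂ,
      visState V b mv s (t + v.length) =
        atTape PrivateTape.allBlank ((wordMat V.idleMat v).mulVec ψ) +
          act (wordMat V.idleMat v) O + N' ∧
      Quiet V mv (t + v.length) N' ∧
      normSq N' + vecNormSq ((wordMat V.idleMat v).mulVec ψ) ≤ normSq N + vecNormSq ψ := by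
  induction v generalizing t ψ O N with
  | nil =>
    refine ⟨N, ?_, hN, ?_⟩
    · rw [wordMat, act_one, Matrix.one_mulVec]; exact hst
    · rw [wordMat, Matrix.one_mulVec]
  | cons a v ih =>
    obtain ⟨h1, h2⟩ := hv
    have hψ0 : SafeQueries V (s t) ψ := by
      have := hψ [] a
      rwa [wordMat, Matrix.one_mulVec, ← h1] at this
    have hO' := hO.quietNext a
    have hN' := hN.quietNext a
    rw [← h1] at hO' hN'
    obtain ⟨N₁, h3, h4, h5⟩ := visState_succ_decomposition hW hV hmv hst hψ0 hO' hN'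
    have h6 := hO'.quiet_act hmv
    rw [h1] at h3 h5 h6
    obtain ⟨N₂, h7, h8, h9⟩ := ih h2 h3 (fun u c => by
      have := hψ (a :: u) c
      rwa [wordMat, ← Matrix.mulVec_mulVec] at this) h6 h4
    rw [show t + 1 + v.length = t + (a :: v).length by rw [List.length_cons]; omega] at h7 h8
    have hw : wordMat V.idleMat (a :: v) =
      wordMat V.idleMat v * V.ampOn V.idle (TapeSymbol.sym a) := rfl
    refine ⟨N₂, ?_, h8, ?_⟩
    · rw [h7, hw, act_mul, Matrix.mulVec_mulVec]
    · rw [hw, ← Matrix.mulVec_mulVec]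
      exact h9.trans h5

theorem visState_word_decomposition {V : Verifier α Q Γ} (hW : V.WellFormed) (hV : V.IsOneWay)
    (hQ : OneQuery V) {b : Δ} {mv : ℕ → ProverMove Γ Δ} (hmv : CommittedMoves b V.blank mv)
    {s : ℕ → TapeSymbol α} (h0 : s 0 = TapeSymbol.cent) {w : List α} (hw : Reads s 1 w) :
    ∃ D : (Q × Γ) × PrivateTape Δ b →₀ ℂ,
      visState V b mv s (1 + w.length) = atTape PrivateTape.allBlank (idleVec V w) + D ∧
      Quiet V mv (1 + w.length) D := by
  have hst : visState V b mv s 0 =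
      atTape PrivateTape.allBlank (Pi.single (V.init, V.blank) 1) + 0 + 0 := by
    rw [visState_zero, add_zero, add_zero]
  obtain ⟨N, h1, h2, -⟩ := visState_succ_decomposition hW hV hmv hst
    (by rw [h0]; exact hQ.safeQueries_cent) (quietNext_zero V mv 0 _) (quietNext_zero V mv 0 _)
  rw [h0, map_zero] at h1
  obtain ⟨N', h3, h4, -⟩ := visState_add_length_decomposition hW hV hmv hw h1 (fun u a => by
    have := hQ.safeQueries_idleVec u a
    rwa [idleVec] at this) (quiet_zero V mv 1) h2
  rw [map_zero, add_zero] at h3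
  exact ⟨N', h3, h4⟩

theorem normSq_visState_le_one {V : Verifier α Q Γ} (hW : V.WellFormed) (hV : V.IsOneWay)
    {b : Δ} {mv : ℕ → ProverMove Γ Δ} {s : ℕ → TapeSymbol α} (t : ℕ) :
    normSq (visState V b mv s t) ≤ 1 := by
  induction t with
  | zero => rw [visState, normSq, Finsupp.sum_single_index (by simp)]; simp
  | succ t ih =>
    rw [visState, normSq_proverAct]
    exact (Verifier.normSq_act_ampOn_le hW hV _ _ _).trans ih

/-- There are arbitrarily good approximate returns, uniformly in the committed prover. -/
theorem exists_near_return {V : Verifier α Q Γ} (hW : V.WellFormed) (hV : V.IsOneWay)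
    (hQ : OneQuery V) (a c : α) {η : ℝ} (hη : 0 < η) :
    ∃ (z : List α) (k : ℕ), 1 ≤ k ∧
      ∀ (Δ : Type) (_ : Fintype Δ) (_ : DecidableEq Δ) (b : Δ) (mv : ℕ → ProverMove Γ Δ)
        (s : ℕ → TapeSymbol α), CommittedMoves b V.blank mv → s 0 = TapeSymbol.cent →
        Reads s 1 (z ++ [c] ++ List.replicate k a) →
        ‖ell2 _ (visState V b mv s (1 + (z ++ [c]).length + k) -
          visState V b mv s (1 + (z ++ [c]).length))‖ ≤ 3 * η := by
  obtain ⟨u, k, hk, hu⟩ := exists_wordMat_near V.idleMat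
    (fun a f => Verifier.vecNormSq_ampOn_le hW hV V.idle (TapeSymbol.sym a) f) a c
    (δ := η ^ 2) (by positivity)
  -- Like `u` and `k`, the word `w` is fixed before any prover is given.
  obtain ⟨w, hw⟩ := exists_forall_append_sub_le (fun w => vecNormSq (idleVec V w))
    (fun w => vecNormSq_nonneg _) (δ := η ^ 2) (by positivity)
  refine ⟨w ++ u, k, hk, ?_⟩
  intro Δ _ _ b mv s hmv h0 hs
  have hs' : Reads s 1 (w ++ (u ++ [c]) ++ List.replicate k a) := by simpa using hs
  obtain ⟨h1, -⟩ := (reads_append s 1 (w ++ (u ++ [c])) (List.replicate k a)).1 hs'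
  obtain ⟨hsw, hsv⟩ := (reads_append s 1 w (u ++ [c])).1 h1
  have hsv' : Reads s (1 + w.length) (u ++ [c] ++ List.replicate k a) := by
    rw [List.append_assoc] at hs'
    exact ((reads_append s 1 w _).1 hs').2
  obtain ⟨D, hD, hDq⟩ := visState_word_decomposition hW hV hQ hmv h0 hsw
  have key : ∀ v : List α, Reads s (1 + w.length) v →
      ∃ N : (Q × Γ) × PrivateTape Δ b →₀ ℂ, visState V b mv s (1 + w.length + v.length) =
        act (wordMat V.idleMat v) (visState V b mv s (1 + w.length)) + N ∧
        ‖ell2 _ N‖ ≤ η := by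
    intro v hv
    -- All answers given up to the end of `w` form the old part `D`. Later ones start from zero and
    -- are bounded by the loss of `idleVec` after `w`, at most `η ^ 2`.
    obtain ⟨N, hN1, -, hN2⟩ := visState_add_length_decomposition hW hV hmv hv
      (hD.trans (add_zero _).symm) (fun u a => by
        have := hQ.safeQueries_idleVec (w ++ u) a
        rwa [idleVec_append] at this) hDq (quiet_zero V mv _)
    refine ⟨N, by rw [hN1, hD, map_add, act_atTape], ?_⟩
    have h3 := hw v
    simp only [idleVec_append] at h3
    have h4 : normSq (0 : (Q × Γ) × PrivateTape Δ b →₀ ℂ) = 0 := by simp [normSq]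
    refine le_of_sq_le_sq ?_ hη.le
    rw [norm_ell2_sq]
    linarith
  obtain ⟨N₁, h2, h3⟩ := key _ hsv
  obtain ⟨N₂, h4, h5⟩ := key _ hsv'
  have e1 : 1 + (w ++ u ++ [c]).length = 1 + w.length + (u ++ [c]).length := by
    simp only [List.length_append]; omega
  have e2 : 1 + (w ++ u ++ [c]).length + k =
      1 + w.length + (u ++ [c] ++ List.replicate k a).length := by
    simp only [List.length_append, List.length_replicate]; omega
  rw [e2, e1, h2, h4]
  set Φ := visState V b mv s (1 + w.length)
  have h6 : ‖ell2 _ (act (wordMat V.idleMat (u ++ [c] ++ List.replicate k a)) Φ -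
      act (wordMat V.idleMat (u ++ [c])) Φ)‖ ≤ η := by
    rw [← act_sub]
    refine le_of_sq_le_sq ?_ hη.le
    rw [norm_ell2_sq]
    refine (normSq_act_le (fun f => vecNormSq_mulVec_le _ f) Φ).trans ?_
    have h7 := normSq_visState_le_one hW hV (b := b) (mv := mv) (s := s) (1 + w.length)
    calc _ ≤ η ^ 2 * 1 := mul_le_mul hu h7 (normSq_nonneg _) (by positivity)
      _ = η ^ 2 := mul_one _
  rw [add_sub_add_comm, map_add, map_sub _ N₂ N₁]
  have h8 := norm_add_le (ell2 _ (act (wordMat V.idleMat (u ++ [c] ++ List.replicate k a)) Φ -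
      act (wordMat V.idleMat (u ++ [c])) Φ)) (ell2 _ N₂ - ell2 _ N₁)
  have h9 := norm_sub_le (ell2 _ N₂) (ell2 _ N₁)
  linarith

end Decomposition

/-! ### Acceptance probabilities -/

section Probability

variable {α Q Γ Δ : Type} [Fintype Q] [DecidableEq Q] [Fintype Γ] [DecidableEq Γ]
  [Fintype Δ] [DecidableEq Δ]

theorem Verifier.normSq_act_ampOn_union (V : Verifier α Q Γ) {A B : Set (Q × Γ)}
    (hAB : Disjoint A B) (σ : TapeSymbol α) {T : Type} (Φ : (Q × Γ) × T →₀ ℂ) :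
    normSq (act (V.ampOn (A ∪ B) σ) Φ) =
      normSq (act (V.ampOn A σ) Φ) + normSq (act (V.ampOn B σ) Φ) := by
  classical
  have h : V.ampOn (A ∪ B) σ = V.ampOn A σ + V.ampOn B σ := by
    ext v' v
    rw [Matrix.add_apply]
    by_cases hA : v' ∈ A
    · have hB : v' ∉ B := Set.disjoint_left.1 hAB hA
      simp [ampOn, hA, hB]
    · by_cases hB : v' ∈ B <;> simp [ampOn, hA, hB]
  rw [h, act_add, normSq_add_of_disjoint]
  rintro ⟨v, y⟩
  rw [act_apply, act_apply, ampOn_mulVec, ampOn_mulVec]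
  by_cases hA : v ∈ A
  · exact Or.inr (if_neg (Set.disjoint_left.1 hAB hA))
  · exact Or.inl (if_neg hA)

/-- The three measurement outcomes are orthogonal parts of a norm-preserving step, and the prover's
turn is an isometry. -/
theorem normSq_halting_add_le {V : Verifier α Q Γ} (hW : V.WellFormed) (hV : V.IsOneWay)
    (b : Δ) (mv : ℕ → ProverMove Γ Δ) (s : ℕ → TapeSymbol α) (t : ℕ) :
    normSq (act (V.ampOn (Verifier.onState V.acc) (s t)) (visState V b mv s t)) +
      normSq (act (V.ampOn (Verifier.onState V.rej) (s t)) (visState V b mv s t)) +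
      normSq (visState V b mv s (t + 1)) ≤ normSq (visState V b mv s t) := by
  have h1 : Disjoint (Verifier.onState (Γ := Γ) V.acc) (Verifier.onState V.rej) :=
    Set.disjoint_left.2 fun _ h h' => Set.disjoint_left.1 V.disjoint_acc_rej h h'
  have h2 : Disjoint (Verifier.onState (Γ := Γ) V.acc ∪ Verifier.onState V.rej)
      (Verifier.onState V.non) :=
    Set.disjoint_left.2 fun _ h h' => h' h
  rw [visState, normSq_proverAct, ← V.normSq_act_ampOn_union h1]
  exact Verifier.normSq_act_ampOn_add_le hW hV h2 _ _

theorem acceptProb_eq {V : Verifier α Q Γ} (hV : V.IsOneWay) (P : Prover α Γ Δ) (x : List α) :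
    acceptProb P V x = ∑ i ∈ Finset.range (x.length + 2),
      normSq (act (V.ampOn (Verifier.onState V.acc) (symSeq x i))
        (visState V P.blank (P.move x) (symSeq x) i)) :=
  Finset.sum_congr rfl fun i _ => normSq_project_verifierOp_evenState hV P x V.acc i

theorem acceptProb_add_rejectProb_le_one {V : Verifier α Q Γ} (hW : V.WellFormed)
    (hV : V.IsOneWay) (P : Prover α Γ Δ) (x : List α) :
    acceptProb P V x + rejectProb P V x ≤ 1 := by
  have key : ∀ n, ∑ i ∈ Finset.range n,
      (normSq (project V.acc (verifierOp V P.blank x (evenState P V x i))) +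
        normSq (project V.rej (verifierOp V P.blank x (evenState P V x i)))) +
      normSq (visState V P.blank (P.move x) (symSeq x) n) ≤ 1 := by
    intro n
    induction n with
    | zero => simpa using normSq_visState_le_one hW hV 0
    | succ n ih =>
      rw [Finset.sum_range_succ, normSq_project_verifierOp_evenState hV,
        normSq_project_verifierOp_evenState hV]
      have := normSq_halting_add_le hW hV P.blank (P.move x) (symSeq x) n
      linarith
  have := key (x.length + 2)
  rw [Finset.sum_add_distrib] at this
  have h0 := normSq_nonneg (visState V P.blank (P.move x) (symSeq x) (x.length + 2))
  rw [acceptProb, rejectProb]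
  linarith

theorem norm_ell2_le_one {ι : Type} {Φ : ι →₀ ℂ} (h : normSq Φ ≤ 1) : ‖ell2 ι Φ‖ ≤ 1 := by
  refine le_of_sq_le_sq ?_ zero_le_one
  rw [norm_ell2_sq]
  linarith

/-- If the states before the right endmarker are close on two inputs on which the prover plays
the same moves, then so are the acceptance probabilities. -/
theorem acceptProb_append_le {V : Verifier α Q Γ} (hW : V.WellFormed) (hV : V.IsOneWay)
    (P P' : Prover α Γ Δ) (z v : List α) (hb : P'.blank = P.blank)
    (hm : P'.move z = P.move (z ++ v)) {d : ℝ}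
    (hd : ‖ell2 _ (visState V P.blank (P.move (z ++ v)) (symSeq (z ++ v))
        (1 + z.length + v.length) -
      visState V P.blank (P.move (z ++ v)) (symSeq (z ++ v)) (1 + z.length))‖ ≤ d) :
    acceptProb P V (z ++ v) ≤ acceptProb P' V z + 4 * d := by
  rw [acceptProb_eq hV, acceptProb_eq hV, hb, hm]
  set mv := P.move (z ++ v)
  set st := visState V P.blank mv (symSeq (z ++ v)) with hst
  have hcongr : ∀ t ≤ 1 + z.length, visState V P.blank mv (symSeq z) t = st t := fun t ht =>
    visState_congr V P.blank mv fun i hi => (symSeq_append_of_le z v (by omega)).symm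
  let acc : ℕ → ℝ := fun i =>
    normSq (act (V.ampOn (Verifier.onState V.acc) (symSeq (z ++ v) i)) (st i))
  -- Acceptance while `v` is read is bounded by the norm lost meanwhile, which is small because the
  -- state nearly returns. This costs `2 * d`, and the step at the right endmarker costs another `2
  -- * d`.
  have htel : ∀ k, ∑ i ∈ Finset.range (1 + z.length + k), acc i ≤
      ∑ i ∈ Finset.range (1 + z.length), acc i +
        (normSq (st (1 + z.length)) - normSq (st (1 + z.length + k))) := by
    intro k
    induction k with
    | zero => simp
    | succ k ih =>
      rw [← add_assoc, Finset.sum_range_succ]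
      have h1 := normSq_halting_add_le hW hV P.blank mv (symSeq (z ++ v)) (1 + z.length + k)
      have h2 := normSq_nonneg (act (V.ampOn (Verifier.onState V.rej)
        (symSeq (z ++ v) (1 + z.length + k))) (st (1 + z.length + k)))
      have h3 : acc (1 + z.length + k) = normSq (act (V.ampOn (Verifier.onState V.acc)
        (symSeq (z ++ v) (1 + z.length + k))) (st (1 + z.length + k))) := rfl
      linarith
  have hsum : ∑ i ∈ Finset.range (1 + z.length),
      normSq (act (V.ampOn (Verifier.onState V.acc) (symSeq z i))
        (visState V P.blank mv (symSeq z) i)) = ∑ i ∈ Finset.range (1 + z.length), acc i := by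
    refine Finset.sum_congr rfl fun i hi => ?_
    rw [Finset.mem_range] at hi
    rw [hcongr i hi.le, ← symSeq_append_of_le z v (by omega)]
  rw [show (z ++ v).length + 2 = 1 + z.length + v.length + 1 by
      rw [List.length_append]; omega,
    show z.length + 2 = 1 + z.length + 1 by omega, Finset.sum_range_succ, Finset.sum_range_succ,
    hsum, hcongr _ le_rfl]
  have e1 : symSeq (z ++ v) (1 + z.length + v.length) = TapeSymbol.dollar := by
    have := symSeq_length_succ (z ++ v)
    rwa [List.length_append, add_comm, ← add_assoc] at this
  have e2 : symSeq z (1 + z.length) = TapeSymbol.dollar := by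
    rw [add_comm]; exact symSeq_length_succ z
  rw [e1, e2]
  set M := V.ampOn (Verifier.onState V.acc) TapeSymbol.dollar
  set Φ := st (1 + z.length + v.length)
  set Ψ := st (1 + z.length)
  have hΦ : normSq Φ ≤ 1 := normSq_visState_le_one hW hV _
  have hΨ : normSq Ψ ≤ 1 := normSq_visState_le_one hW hV _
  have hM : ∀ Θ : (Q × Γ) × PrivateTape Δ P.blank →₀ ℂ, normSq (act M Θ) ≤ normSq Θ :=
    fun Θ => Verifier.normSq_act_ampOn_le hW hV _ _ Θ
  have bound : ∀ (A B : (Q × Γ) × PrivateTape Δ P.blank →₀ ℂ), normSq A ≤ 1 → normSq B ≤ 1 →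
      ‖ell2 _ (A - B)‖ ≤ d → normSq A - normSq B ≤ 2 * d := by
    intro A B hA hB hAB
    have h1 := normSq_sub_le A B
    have h2 := norm_ell2_le_one hA
    have h3 := norm_ell2_le_one hB
    nlinarith [norm_nonneg (ell2 _ (A - B)), norm_nonneg (ell2 _ A), norm_nonneg (ell2 _ B)]
  have h1 : normSq Ψ - normSq Φ ≤ 2 * d := bound Ψ Φ hΨ hΦ (by
    rw [map_sub, norm_sub_rev, ← map_sub]; exact hd)
  have h2 : normSq (act M Φ) - normSq (act M Ψ) ≤ 2 * d := by
    refine bound _ _ ((hM _).trans hΦ) ((hM _).trans hΨ) (le_trans ?_ hd)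
    rw [← map_sub]
    refine le_of_sq_le_sq ?_ (norm_nonneg _)
    rw [norm_ell2_sq, norm_ell2_sq]
    exact hM _
  have h3 := htel v.length
  change _ + normSq (act M Φ) ≤ _ + normSq (act M Ψ) + _
  linarith

end Probability

/-! ### The language of the words that end in `0` -/

theorem append_singleton_mem_zeroLang (x : List (Fin 2)) (a : Fin 2) :
    x ++ [a] ∈ zeroLang ↔ a = 0 := by
  constructor
  · rintro ⟨y, hy⟩
    exact (List.append_inj' hy rfl).2 |> List.singleton_inj.1
  · rintro rfl
    exact ⟨x, rfl⟩

/-- Two states suffice, recording whether the last letter read was `0`. -/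
theorem isRegular_zeroLang : zeroLang.IsRegular := by
  let M : DFA (Fin 2) Bool := ⟨fun _ a => decide (a = 0), false, {true}⟩
  refine ⟨Bool, inferInstance, M, ?_⟩
  ext w
  rcases List.eq_nil_or_concat w with rfl | ⟨x, a, rfl⟩
  · constructor
    · intro h
      exact absurd h (by simp [M, DFA.mem_accepts, DFA.eval, DFA.evalFrom])
    · rintro ⟨y, hy⟩
      simp at hy
  · rw [List.concat_eq_append, append_singleton_mem_zeroLang, DFA.mem_accepts,
      DFA.eval_append_singleton]
    simp [M]

theorem zeroLang_notMem_QIPSharp_one : zeroLang ∉ QIPSharp (Fin 2) 1 := by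
  rintro ⟨Q, Γ, _, _, _, _, V, hW, hV, Δ, _, _, P, hP, ⟨ε, -, hε, hacc, hrej⟩, -, hI⟩
  have hQ : OneQuery V := fun w γ hγ γ' => tensorSym_mem_noQuery hV 1
    (fun x P' hP' => hI (x ++ [1]) (by rw [append_singleton_mem_zeroLang]; decide)
      Bool inferInstance inferInstance P' hP') w hγ γ'
  -- With this `η` the acceptance probabilities differ by at most `4 * (3 * η) = (1 - 2 * ε) / 2`,
  -- half of the gap between `ε` and `1 - ε`.
  obtain ⟨z, k, hk, hz⟩ := exists_near_return hW hV hQ 0 1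
    (η := (1 - 2 * ε) / 24) (by linarith)
  set z' := z ++ [1]
  set v := List.replicate k (0 : Fin 2)
  have hin : z' ++ v ∈ zeroLang := by
    obtain ⟨m, rfl⟩ := Nat.exists_eq_add_of_le' hk
    refine ⟨z' ++ List.replicate m 0, ?_⟩
    rw [List.append_assoc z', ← List.replicate_succ']
  have hout : z' ∉ zeroLang := by
    rw [append_singleton_mem_zeroLang]; decide
  -- The cheating prover plays on every input the honest moves for `z' ++ v`.
  let P' : Prover (Fin 2) Γ Δ := ⟨P.blank, fun _ => P.move (z' ++ v)⟩
  have hP' : P'.Committed V.blank := by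
    rw [committed_iff] at hP ⊢
    exact fun _ => hP (z' ++ v)
  have h1 := hz Δ inferInstance inferInstance P.blank (P.move (z' ++ v)) (symSeq (z' ++ v))
    ((committed_iff P V.blank).1 hP _) (symSeq_zero _) (reads_symSeq _)
  have h2 := acceptProb_append_le hW hV P P' z' v rfl rfl (d := 3 * ((1 - 2 * ε) / 24)) (by
    rw [show v.length = k from List.length_replicate]; exact h1)
  have h3 := hacc _ hin
  have h4 := hrej _ hout Δ inferInstance inferInstance P' hP'
  have h5 := acceptProb_add_rejectProb_le_one hW hV P' z'
  linarith

end QIP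

theorem mainTheorem2 : QIP.zeroLang.IsRegular ∧ QIP.zeroLang ∉ QIP.QIPSharp (Fin 2) 1 :=
  ⟨QIP.isRegular_zeroLang, QIP.zeroLang_notMem_QIPSharp_one⟩
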